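/- **Setting.** Let $G$ be a simple undirected graph on the fixed vertex set $\{0,\dots,n-1\}$ that starts as an arbitrary graph and undergoes an arbitrary sequence of updates, each inserting one absent edge or deleting one present edge. A subgraph $F\subseteq G$ on the same vertices is a *maximal spanning forest* of $G$ if it is acyclic and has the same connected components as $G$. Algorithms are fixed programs (one for all $n$) for a random access machine with logarithmic cost, which may flip fair coins. A dynamic algorithm consists of an initialization, an insertion, a deletion, and one or more query procedures that work on a common memory; the answers and outputs described below are required on every run that halts. *Update time $\tilde O(1)$* means: there are constants $C,k$, depending only on the algorithm, such that every single update and every single admissible query, from every memory state and graph that can be reached by initialization followed by legal updates, admissible queries and arbitrary coin outcomes, takes time at most $C(\lfloor\log_2 n\rfloor+1)^k$ (where $\lfloor\log_2 0\rfloor$ is read as $0$). Fix one of two regimes: (a) *worst case*: the bound holds for every outcome of the coins; (b) *expected worst case*: from every such state the operation halts with probability $1$ and its expected time obeys the bound. The initialization has to halt on every initial graph (for all coin outcomes in (a), with probability $1$ in (b)). An algorithm *provides query access to a maximal spanning forest* if its memory always represents some maximal spanning forest $F'$ of the current $G$, where $F'$ may change arbitrarily with each update but is not changed by queries, and it answers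 for vertices $u,v$ the queries: are $u,v$ connected in $G$; is $uv$ an edge of $F'$; and, admissible if $u,v$ are connected, what is a midpoint of the path $F'[u,v]$ (a vertex at distance $\lfloor d/2\rfloor$ or $\lceil d/2\rceil$ from $u$ on it, $d$ being its length). An algorithm *explicitly maintains a maximal spanning forest via at most $2$ changes per update* if its initialization outputs the list of edges of a forest $F$, and each update of $G$ outputs a list of at most two edge insertions and deletions to be applied to $F$, such that $F$ is a maximal spanning forest of $G$ after the initialization and after every update. **Lemma.** Let $\mathcal A$ be a dynamic algorithm with update time $\tilde O(1)$ that provides query access to a maximal spanning forest. Then there is a dynamic connectivity algorithm $\mathcal B$ with update time $\tilde O(1)$ in the same regime, answering queries whether $u,v$ are connected in $G$, that explicitly maintains a maximal spanning forest via at most $2$ changes per update. Moreover, if $\mathcal A$ uses no coins, $\mathcal B$ can be taken to use none, and if the initialization of $\mathcal A$ takes time at most $C(n+m+1)(\lfloor\log_2 n\rfloor+1)^k$ on every $n$-vertex, $m$-edge initial graph for some constants $C,k$ (in the same regime), then $\mathcal B$ can be taken to have such an initialization bound too. -/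

import Mathlib

open scoped ENNReal

namespace DynForest

/-! ### Random access machine with logarithmic cost -/

/-- Memory of the machine: registers, and arrays whose cells are addressed by register contents.
A program mentions only finitely many registers and arrays, by fixed names. -/
structure State where
  reg : ℕ → ℕ
  arr : ℕ → ℕ → ℕ

def State.setReg (s : State) (r x : ℕ) : State :=
  { s with reg := Function.update s.reg r x }

def State.setArr (s : State) (a i x : ℕ) : State :=
  { s with arr := Function.update s.arr a (Function.update (s.arr a) i x) }

inductive BinOp
  | add | sub | mul | div

/-- Subtraction is truncated at zero, division rounds down, and `x / 0 = 0`. -/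
def BinOp.eval : BinOp → ℕ → ℕ → ℕ
  | .add, x, y => x + y
  | .sub, x, y => x - y
  | .mul, x, y => x * y
  | .div, x, y => x / y

/-- Programs. In `load r a i` and `store a i r` the index `i` names the register that holds the
address within the array `a`. `branch r p q` runs `p` if register `r` is nonzero and `q` otherwise;
`loop r p` repeats `p` while register `r` is nonzero; `flip r` puts a fair random bit into `r`. -/
inductive Prog
  | skip
  | const (r x : ℕ)
  | arith (o : BinOp) (r x y : ℕ)
  | load (r a i : ℕ)
  | store (a i r : ℕ)
  | flip (r : ℕ)
  | seq (p q : Prog)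
  | branch (r : ℕ) (p q : Prog)
  | loop (r : ℕ) (p : Prog)

/-- The program uses no random bits. -/
def Prog.IsDeterministic : Prog → Prop
  | .flip _ => False
  | .seq p q => p.IsDeterministic ∧ q.IsDeterministic
  | .branch _ p q => p.IsDeterministic ∧ q.IsDeterministic
  | .loop _ p => p.IsDeterministic
  | _ => True

/-- `Run p s b s' t`: started in `s`, the program `p` halts in `s'` after time `t`, having consumed
exactly the random bits `b`. The time of an instruction is one plus the bit lengths of the numbers
and addresses that it handles. -/
inductive Run : Prog → State → List Bool → State → ℕ → Prop
  | skip (s : State) : Run .skip s [] s 1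
  | const (s : State) (r x : ℕ) : Run (.const r x) s [] (s.setReg r x) (1 + x.size)
  | arith (s : State) (o : BinOp) (r x y : ℕ) :
      Run (.arith o r x y) s [] (s.setReg r (o.eval (s.reg x) (s.reg y)))
        (1 + (s.reg x).size + (s.reg y).size)
  | load (s : State) (r a i : ℕ) :
      Run (.load r a i) s [] (s.setReg r (s.arr a (s.reg i)))
        (1 + (s.reg i).size + (s.arr a (s.reg i)).size)
  | store (s : State) (a i r : ℕ) :
      Run (.store a i r) s [] (s.setArr a (s.reg i) (s.reg r))
        (1 + (s.reg i).size + (s.reg r).size)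
  | flip (s : State) (r : ℕ) (c : Bool) : Run (.flip r) s [c] (s.setReg r c.toNat) 1
  | seq {p q : Prog} {s s₁ s₂ : State} {b₁ b₂ : List Bool} {t₁ t₂ : ℕ}
      (h₁ : Run p s b₁ s₁ t₁) (h₂ : Run q s₁ b₂ s₂ t₂) :
      Run (.seq p q) s (b₁ ++ b₂) s₂ (t₁ + t₂)
  | branch_pos {r : ℕ} {p q : Prog} {s s' : State} {b : List Bool} {t : ℕ}
      (hr : s.reg r ≠ 0) (h : Run p s b s' t) :
      Run (.branch r p q) s b s' (1 + (s.reg r).size + t)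
  | branch_zero {r : ℕ} {p q : Prog} {s s' : State} {b : List Bool} {t : ℕ}
      (hr : s.reg r = 0) (h : Run q s b s' t) :
      Run (.branch r p q) s b s' (1 + t)
  | loop_zero {r : ℕ} {p : Prog} {s : State} (hr : s.reg r = 0) : Run (.loop r p) s [] s 1
  | loop_pos {r : ℕ} {p : Prog} {s s₁ s₂ : State} {b₁ b₂ : List Bool} {t₁ t₂ : ℕ}
      (hr : s.reg r ≠ 0) (h₁ : Run p s b₁ s₁ t₁) (h₂ : Run (.loop r p) s₁ b₂ s₂ t₂) :
      Run (.loop r p) s (b₁ ++ b₂) s₂ (1 + (s.reg r).size + t₁ + t₂)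

/-- How running times are measured: for every outcome of the random bits, or in expectation over
the random bits. For deterministic programs only the first is of interest. -/
inductive Regime
  | worstCase
  | expected

/-- Probability that `p` halts when started in `s` (the halting bit strings are prefix-free). -/
noncomputable def haltProb (p : Prog) (s : State) : ℝ≥0∞ :=
  ∑' b : List Bool, ⨆ (s' : State) (t : ℕ) (_ : Run p s b s' t), (2⁻¹ : ℝ≥0∞) ^ b.length

/-- Expectation of the running time, restricted to the event that `p` halts. -/
noncomputable def meanTime (p : Prog) (s : State) : ℝ≥0∞ :=
  ∑' b : List Bool, ⨆ (s' : State) (t : ℕ) (_ : Run p s b s' t),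
    (t : ℝ≥0∞) * (2⁻¹ : ℝ≥0∞) ^ b.length

/-- The program halts, on every infinite stream of random bits, or with probability one. -/
def Halts : Regime → Prog → State → Prop
  | .worstCase, p, s => ∀ ω : ℕ → Bool, ∃ (k : ℕ) (s' : State) (t : ℕ),
      Run p s ((List.range k).map ω) s' t
  | .expected, p, s => haltProb p s = 1

/-- The program halts within time `T`, on every infinite stream of random bits, or it halts with
probability one and in expected time at most `T`. -/
def HaltsWithin : Regime → Prog → State → ℕ → Prop
  | .worstCase, p, s, T => ∀ ω : ℕ → Bool, ∃ (k : ℕ) (s' : State) (t : ℕ),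
      Run p s ((List.range k).map ω) s' t ∧ t ≤ T
  | .expected, p, s, T => haltProb p s = 1 ∧ meanTime p s ≤ T

/-! ### Graphs, forests and edge updates -/

inductive UpdateKind
  | insert | delete

/-- One may insert an absent edge between distinct vertices and delete an edge that is present. -/
def UpdateKind.Legal {n : ℕ} :
    UpdateKind → SimpleGraph (Fin n) → Fin n → Fin n → Prop
  | .insert, G, u, v => u ≠ v ∧ ¬ G.Adj u v
  | .delete, G, u, v => G.Adj u v

def UpdateKind.apply {n : ℕ} :
    UpdateKind → SimpleGraph (Fin n) → Fin n → Fin n → SimpleGraph (Fin n)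
  | .insert, G, u, v => G ⊔ SimpleGraph.edge u v
  | .delete, G, u, v => G.deleteEdges {s(u, v)}

/-- `F` is a forest contained in `G` with the same vertices and the same connected components. -/
def IsMaximalSpanningForest {n : ℕ} (F G : SimpleGraph (Fin n)) : Prop :=
  F.IsAcyclic ∧ F ≤ G ∧ ∀ u v, F.Reachable u v ↔ G.Reachable u v

/-- `z` is a midpoint of a path from `x` to `y` in `F`; a path of odd length has two of them. -/
def IsMidpoint {n : ℕ} (F : SimpleGraph (Fin n)) (x y z : Fin n) : Prop :=
  ∃ p : F.Walk x y, p.IsPath ∧ (z = p.getVert (p.length / 2) ∨ z = p.getVert ((p.length + 1) / 2))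

/-- `Changes L F F'`: the edge insertions and deletions in `L` are legal when they are carried out
one after the other starting from `F`, and they lead to `F'`. -/
inductive Changes {n : ℕ} :
    List (UpdateKind × ℕ × ℕ) → SimpleGraph (Fin n) → SimpleGraph (Fin n) → Prop
  | nil (F : SimpleGraph (Fin n)) : Changes [] F F
  | cons {k : UpdateKind} {u v : Fin n} {L : List (UpdateKind × ℕ × ℕ)}
      {F F' : SimpleGraph (Fin n)} (h : k.Legal F u v) (hL : Changes L (k.apply F u v) F') :
      Changes ((k, (u : ℕ), (v : ℕ)) :: L) F F'

/-! ### Queries -/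

/-- The queries: are `u` and `v` connected in the graph, is `uv` an edge of the forest, and what is
the midpoint of the path from `u` to `v` in the forest? -/
inductive Query
  | connected | forestEdge | midpoint

/-- A midpoint may be asked for only if there is a path. -/
def Query.Legal {n : ℕ} : Query → SimpleGraph (Fin n) → Fin n → Fin n → Prop
  | .midpoint, G, u, v => G.Reachable u v
  | _, _, _, _ => True

/-- `a` is a right answer for the graph `G` with forest `F`. Nonzero means yes, zero means no. -/
def Query.Answer {n : ℕ} :
    Query → SimpleGraph (Fin n) → SimpleGraph (Fin n) → Fin n → Fin n → ℕ → Prop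
  | .connected, G, _, u, v, a => a ≠ 0 ↔ G.Reachable u v
  | .forestEdge, _, F, u, v, a => a ≠ 0 ↔ F.Adj u v
  | .midpoint, _, F, u, v, a => ∃ z : Fin n, a = z ∧ IsMidpoint F u v z

/-! ### Dynamic graph algorithms -/

/-- A dynamic graph algorithm that supports the queries in `Q`: fixed programs, the same for all
graphs, that work on a common memory. -/
structure DynAlg (Q : Set Query) where
  init : Prog
  update : UpdateKind → Prog
  query : Q → Prog

/-- `L` lists every edge of `G` exactly once, in either orientation. -/
def Lists {n : ℕ} (L : List (Fin n × Fin n)) (G : SimpleGraph (Fin n)) : Prop :=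
  (L.map fun e => s(e.1, e.2)).Nodup ∧ ∀ e, e ∈ L.map (fun e => s(e.1, e.2)) ↔ e ∈ G.edgeSet

/-- The memory on which the initialization starts: register 0 holds `n`, register 1 the number of
edges, and cells `2 * j` and `2 * j + 1` of array 0 the endpoints of the `j`-th edge. Everything
else is zero. -/
def inputState (n : ℕ) (L : List (Fin n × Fin n)) : State where
  reg r := if r = 0 then n else if r = 1 then L.length else 0
  arr a i := if a = 0 then (L.flatMap fun e => [(e.1 : ℕ), (e.2 : ℕ)]).getD i 0 else 0

/-- Updates and queries get their two vertices in registers 0 and 1. -/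
def State.call {n : ℕ} (s : State) (u v : Fin n) : State :=
  (s.setReg 0 u).setReg 1 v

/-- A list of edge insertions and deletions that has been written to memory: register 0 holds its
length; the cells `3 * j`, `3 * j + 1`, `3 * j + 2` of array 0 hold the kind of the `j`-th entry
(zero for a deletion, nonzero for an insertion) and the two endpoints. -/
def State.output (s : State) : List (UpdateKind × ℕ × ℕ) :=
  (List.range (s.reg 0)).map fun j =>
    (if s.arr 0 (3 * j) = 0 then UpdateKind.delete else UpdateKind.insert,
      s.arr 0 (3 * j + 1), s.arr 0 (3 * j + 2))

namespace DynAlg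

variable {Q : Set Query}

/-- `D.Reach n s G`: some initial graph on `n` vertices, some sequence of legal updates and queries
and some outcome of the random bits lead to the graph `G` and the memory contents `s`. -/
inductive Reach (D : DynAlg Q) (n : ℕ) : State → SimpleGraph (Fin n) → Prop
  | init {L : List (Fin n × Fin n)} {G : SimpleGraph (Fin n)} {b : List Bool} {s : State} {t : ℕ}
      (hL : Lists L G) (h : Run D.init (inputState n L) b s t) : Reach D n s G
  | update {s s' : State} {G : SimpleGraph (Fin n)} {k : UpdateKind} {u v : Fin n}
      {b : List Bool} {t : ℕ} (hs : Reach D n s G) (hk : k.Legal G u v)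
      (h : Run (D.update k) (s.call u v) b s' t) : Reach D n s' (k.apply G u v)
  | query {s s' : State} {G : SimpleGraph (Fin n)} {q : Q} {u v : Fin n}
      {b : List Bool} {t : ℕ} (hs : Reach D n s G) (hq : q.1.Legal G u v)
      (h : Run (D.query q) (s.call u v) b s' t) : Reach D n s' G

/-- As `Reach`; in addition `F` is the graph that results from carrying out, starting from the graph
without edges, all insertions and deletions that the initialization and the updates have output. -/
inductive ReachOut (D : DynAlg Q) (n : ℕ) :
    State → SimpleGraph (Fin n) → SimpleGraph (Fin n) → Prop
  | init {L : List (Fin n × Fin n)} {G F : SimpleGraph (Fin n)} {b : List Bool} {s : State} {t : ℕ}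
      (hL : Lists L G) (h : Run D.init (inputState n L) b s t) (hF : Changes s.output ⊥ F) :
      ReachOut D n s G F
  | update {s s' : State} {G F F' : SimpleGraph (Fin n)} {k : UpdateKind} {u v : Fin n}
      {b : List Bool} {t : ℕ} (hs : ReachOut D n s G F) (hk : k.Legal G u v)
      (h : Run (D.update k) (s.call u v) b s' t) (hF : Changes s'.output F F') :
      ReachOut D n s' (k.apply G u v) F'
  | query {s s' : State} {G F : SimpleGraph (Fin n)} {q : Q} {u v : Fin n}
      {b : List Bool} {t : ℕ} (hs : ReachOut D n s G F) (hq : q.1.Legal G u v)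
      (h : Run (D.query q) (s.call u v) b s' t) : ReachOut D n s' G F

/-- No operation uses random bits. -/
def IsDeterministic (D : DynAlg Q) : Prop :=
  D.init.IsDeterministic ∧ (∀ k, (D.update k).IsDeterministic) ∧ ∀ q, (D.query q).IsDeterministic

/-- The initialization halts on every graph. -/
def InitHalts (r : Regime) (D : DynAlg Q) : Prop :=
  ∀ (n : ℕ) (G : SimpleGraph (Fin n)) (L : List (Fin n × Fin n)), Lists L G →
    Halts r D.init (inputState n L)

/-- The initialization takes time `(n + m) * polylog n` on graphs with `n` vertices and `m` edges. -/
def InitNearLinear (r : Regime) (D : DynAlg Q) : Prop :=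
  ∃ C k : ℕ, ∀ (n : ℕ) (G : SimpleGraph (Fin n)) (L : List (Fin n × Fin n)), Lists L G →
    HaltsWithin r D.init (inputState n L) (C * (n + L.length + 1) * (Nat.log 2 n + 1) ^ k)

/-- Every single update and every single query, in every situation that can occur, takes time
`polylog n`, where `n` is the number of vertices. -/
def PolylogTime (r : Regime) (D : DynAlg Q) : Prop :=
  ∃ C k : ℕ, ∀ (n : ℕ) (s : State) (G : SimpleGraph (Fin n)), D.Reach n s G →
    ∀ u v : Fin n,
      (∀ κ : UpdateKind, κ.Legal G u v →
        HaltsWithin r (D.update κ) (s.call u v) (C * (Nat.log 2 n + 1) ^ k)) ∧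
      ∀ q : Q, q.1.Legal G u v →
        HaltsWithin r (D.query q) (s.call u v) (C * (Nat.log 2 n + 1) ^ k)

/-- The memory always represents some maximal spanning forest of the current graph. Queries leave
this forest unchanged and are answered in accordance with it (register 0 holds the answer). An
update may change the forest arbitrarily. -/
def ProvidesForestAccess (D : DynAlg Q) : Prop :=
  ∃ forest : ∀ n : ℕ, State → SimpleGraph (Fin n),
    ∀ (n : ℕ) (s : State) (G : SimpleGraph (Fin n)), D.Reach n s G →
      IsMaximalSpanningForest (forest n s) G ∧
      ∀ (q : Q) (u v : Fin n), q.1.Legal G u v →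
        ∀ (b : List Bool) (s' : State) (t : ℕ), Run (D.query q) (s.call u v) b s' t →
          forest n s' = forest n s ∧ q.1.Answer G (forest n s) u v (s'.reg 0)

/-- The initialization outputs the edges of a forest, and every update outputs a list of at most two
edge insertions and deletions, such that the forest `F` given by these outputs is at all times a
maximal spanning forest of the current graph. All queries are answered correctly. -/
def ExplicitlyMaintainsForest (D : DynAlg Q) : Prop :=
  ∀ n : ℕ,
    (∀ (L : List (Fin n × Fin n)) (G : SimpleGraph (Fin n)), Lists L G →
      ∀ (b : List Bool) (s : State) (t : ℕ), Run D.init (inputState n L) b s t →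
        ∃ F : SimpleGraph (Fin n), Changes s.output ⊥ F) ∧
    ∀ (s : State) (G F : SimpleGraph (Fin n)), D.ReachOut n s G F →
      IsMaximalSpanningForest F G ∧
      (∀ (k : UpdateKind) (u v : Fin n), k.Legal G u v →
        ∀ (b : List Bool) (s' : State) (t : ℕ), Run (D.update k) (s.call u v) b s' t →
          s'.output.length ≤ 2 ∧ ∃ F' : SimpleGraph (Fin n), Changes s'.output F F') ∧
      ∀ (q : Q) (u v : Fin n), q.1.Legal G u v →
        ∀ (b : List Bool) (s' : State) (t : ℕ), Run (D.query q) (s.call u v) b s' t →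
          q.1.Answer G F u v (s'.reg 0)

end DynAlg

end DynForest

/-! Two copies of the given algorithm run side by side, one on the graph `G` and one on the explicit
forest `F`, regarded as a graph in its own right. A forest has no maximal spanning forest but itself
(`IsMaximalSpanningForest.eq_of_isAcyclic`), so the second copy decides membership in `F`, and its
connectivity queries see the components of `F`. The first copy represents a forest `F'` of `G` that
need not have anything to do with `F`.

The only update that needs work is the deletion of an edge `uv` of `F` whose end points stay
connected in `G`. Then the path `F'[u,v]` starts inside the component of `u` in `F - uv` and ends
outside, so one of its edges `xy` leaves that component, and any such edge repairs `F`
(`IsMaximalSpanningForest.replace`). It is found by binary search (`Oracle.search_step`): the first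
copy supplies midpoints, the second tells on which side they lie. Queries do not change `F'`, so the
path stands still meanwhile. A path has at most `n ≤ 2 ^ S` edges, hence `S` rounds suffice, and the
output is one deletion and one insertion.

Initially the first copy is started on `G` and asked for each input edge whether it belongs to `F'`;
the edges found are output, and they are the input on which the second copy is started.

The rest concerns the machine. The halting bit strings are prefix-free (`Run.unique`), so
probabilities and expectations of a composition are sums over pairs of runs; this yields one
composition rule for both regimes (`HaltsBy.seq`) and a program logic on top of it (`Triple`).
Renaming registers and arrays lets both copies live in one memory (`Run.exists_rename`,
`Run.of_rename`). Answers of arbitrary size are harmless because writing them costs time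
(`Run.size_reg_le`). -/

namespace DynForest

/-! ### Runs are determined by the random bits -/

/-- The continuations `c₁`, `c₂` make this determinism and prefix-freeness at once, and the
induction through sequences and loops needs both: the first parts of two runs are only known to be
prefixes of a common string. -/
theorem Run.unique {p : Prog} {s s₁ : State} {b₁ : List Bool} {t₁ : ℕ} (h : Run p s b₁ s₁ t₁) :
    ∀ {b₂ c₁ c₂ : List Bool} {s₂ : State} {t₂ : ℕ}, Run p s b₂ s₂ t₂ → b₁ ++ c₁ = b₂ ++ c₂ →
      b₁ = b₂ ∧ s₁ = s₂ ∧ t₁ = t₂ := by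
  induction h with
  | skip | const | arith | load | store =>
    intro b₂ c₁ c₂ s₂ t₂ h₂ _
    cases h₂
    exact ⟨rfl, rfl, rfl⟩
  | flip s r c =>
    intro b₂ c₁ c₂ s₂ t₂ h₂ hb
    cases h₂
    simp only [List.cons_append, List.cons.injEq] at hb
    obtain ⟨rfl, -⟩ := hb
    exact ⟨rfl, rfl, rfl⟩
  | seq _ _ ih₁ ih₂ =>
    intro b₂ c₁ c₂ s₂ t₂ h₂ hb
    cases h₂ with
    | seq k₁ k₂ =>
      rw [List.append_assoc, List.append_assoc] at hb
      obtain ⟨rfl, rfl, rfl⟩ := ih₁ k₁ hb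
      obtain ⟨rfl, rfl, rfl⟩ := ih₂ k₂ (List.append_cancel_left hb)
      exact ⟨rfl, rfl, rfl⟩
  | branch_pos hr _ ih =>
    intro b₂ c₁ c₂ s₂ t₂ h₂ hb
    cases h₂ with
    | branch_pos _ k =>
      obtain ⟨rfl, rfl, rfl⟩ := ih k hb
      exact ⟨rfl, rfl, rfl⟩
    | branch_zero hr' _ => exact absurd hr' hr
  | branch_zero hr _ ih =>
    intro b₂ c₁ c₂ s₂ t₂ h₂ hb
    cases h₂ with
    | branch_zero _ k =>
      obtain ⟨rfl, rfl, rfl⟩ := ih k hb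
      exact ⟨rfl, rfl, rfl⟩
    | branch_pos hr' _ => exact absurd hr hr'
  | loop_zero hr =>
    intro b₂ c₁ c₂ s₂ t₂ h₂ hb
    cases h₂ with
    | loop_zero _ => exact ⟨rfl, rfl, rfl⟩
    | loop_pos hr' _ _ => exact absurd hr hr'
  | loop_pos hr _ _ ih₁ ih₂ =>
    intro b₂ c₁ c₂ s₂ t₂ h₂ hb
    cases h₂ with
    | loop_zero hr' => exact absurd hr' hr
    | loop_pos _ k₁ k₂ =>
      rw [List.append_assoc, List.append_assoc] at hb
      obtain ⟨rfl, rfl, rfl⟩ := ih₁ k₁ hb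
      obtain ⟨rfl, rfl, rfl⟩ := ih₂ k₂ (List.append_cancel_left hb)
      exact ⟨rfl, rfl, rfl⟩

/-! ### Halting probability and expected time as sums over the runs -/

/-- The runs of `p` from `s`: random bits, final state and time. -/
abbrev Outcome (p : Prog) (s : State) : Type :=
  {x : List Bool × State × ℕ // Run p s x.1 x.2.1 x.2.2}

theorem Outcome.ext_bits {p : Prog} {s : State} {x y : Outcome p s} (h : x.1.1 = y.1.1) :
    x = y := by
  obtain ⟨⟨b, s₁, t₁⟩, hx⟩ := x
  obtain ⟨⟨b', s₂, t₂⟩, hy⟩ := y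
  obtain rfl : b = b' := h
  obtain ⟨-, h₁, h₂⟩ := hx.unique (c₁ := []) (c₂ := []) hy rfl
  subst h₁ h₂
  rfl

/-- A bit string determines its run, so each supremum ranges over at most one value and the sum over
strings becomes a sum over runs. -/
theorem tsum_iSup_run (p : Prog) (s : State) (g : List Bool → ℕ → ℝ≥0∞) :
    (∑' b : List Bool, ⨆ (s' : State) (t : ℕ) (_ : Run p s b s' t), g b t) =
      ∑' x : Outcome p s, g x.1.1 x.1.2.2 := by
  have hinj : Function.Injective (fun x : Outcome p s => x.1.1) :=
    fun x y h => Outcome.ext_bits h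
  rw [← hinj.tsum_eq]
  · refine tsum_congr fun x => ?_
    apply le_antisymm
    · refine iSup_le fun s' => iSup_le fun t => iSup_le fun h => ?_
      obtain ⟨-, -, h₂⟩ := h.unique (c₁ := []) (c₂ := []) x.2 rfl
      rw [h₂]
    · exact le_iSup_of_le x.1.2.1 (le_iSup_of_le x.1.2.2 (le_iSup_of_le x.2 le_rfl))
  -- A string on which no run halts contributes an empty supremum, which is zero.
  · intro b hb
    by_contra hn
    refine hb ?_
    simp only [ENNReal.iSup_eq_zero]
    intro s' t h
    exact absurd ⟨⟨(b, s', t), h⟩, rfl⟩ hn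

theorem haltProb_eq (p : Prog) (s : State) :
    haltProb p s = ∑' x : Outcome p s, (2⁻¹ : ℝ≥0∞) ^ x.1.1.length :=
  tsum_iSup_run p s fun b _ => (2⁻¹ : ℝ≥0∞) ^ b.length

theorem meanTime_eq (p : Prog) (s : State) :
    meanTime p s = ∑' x : Outcome p s, (x.1.2.2 : ℝ≥0∞) * (2⁻¹ : ℝ≥0∞) ^ x.1.1.length :=
  tsum_iSup_run p s fun b t => (t : ℝ≥0∞) * (2⁻¹ : ℝ≥0∞) ^ b.length

/-- A run of a sequence is a run of the first program followed by a run of the second. -/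
def Outcome.append {p q : Prog} {s : State} (x : Σ x : Outcome p s, Outcome q x.1.2.1) :
    Outcome (.seq p q) s :=
  ⟨(x.1.1.1 ++ x.2.1.1, x.2.1.2.1, x.1.1.2.2 + x.2.1.2.2), .seq x.1.2 x.2.2⟩

/-- Prefix-freeness fixes the point at which the bits of a composed run are to be cut. -/
theorem Outcome.append_bijective (p q : Prog) (s : State) :
    Function.Bijective (Outcome.append (p := p) (q := q) (s := s)) := by
  constructor
  · rintro ⟨x, y⟩ ⟨x', y'⟩ h
    have hb : x.1.1 ++ y.1.1 = x'.1.1 ++ y'.1.1 := congrArg (fun z => z.1.1) h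
    obtain ⟨h₁, -, -⟩ := x.2.unique x'.2 hb
    obtain rfl := Outcome.ext_bits h₁
    obtain rfl : y = y' := Outcome.ext_bits (List.append_cancel_left hb)
    rfl
  · rintro ⟨⟨b, s', t⟩, h⟩
    cases h with
    | seq h₁ h₂ => exact ⟨⟨⟨(_, _, _), h₁⟩, ⟨(_, _, _), h₂⟩⟩, rfl⟩

theorem tsum_outcome_seq (p q : Prog) (s : State) (g : Outcome (.seq p q) s → ℝ≥0∞) :
    ∑' z, g z = ∑' x : Outcome p s, ∑' y : Outcome q x.1.2.1, g (Outcome.append ⟨x, y⟩) := by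
  rw [← (Equiv.ofBijective _ (Outcome.append_bijective p q s)).tsum_eq, ENNReal.tsum_sigma']
  rfl

theorem haltProb_seq (p q : Prog) (s : State) :
    haltProb (.seq p q) s =
      ∑' x : Outcome p s, (2⁻¹ : ℝ≥0∞) ^ x.1.1.length * haltProb q x.1.2.1 := by
  rw [haltProb_eq, tsum_outcome_seq]
  refine tsum_congr fun x => ?_
  rw [haltProb_eq, ← ENNReal.tsum_mul_left]
  refine tsum_congr fun y => ?_
  simp [Outcome.append, pow_add]

/-- Only halting runs count towards the mean, so the time of the first part is weighted with the
probability that the second part halts. -/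
theorem meanTime_seq (p q : Prog) (s : State) :
    meanTime (.seq p q) s =
      ∑' x : Outcome p s, (2⁻¹ : ℝ≥0∞) ^ x.1.1.length *
        (x.1.2.2 * haltProb q x.1.2.1 + meanTime q x.1.2.1) := by
  rw [meanTime_eq, tsum_outcome_seq]
  refine tsum_congr fun x => ?_
  rw [haltProb_eq, meanTime_eq, ← ENNReal.tsum_mul_left, ← ENNReal.tsum_add,
    ← ENNReal.tsum_mul_left]
  refine tsum_congr fun y => ?_
  simp only [Outcome.append, List.length_append, pow_add, Nat.cast_add]
  ring

/-! ### Time bounds -/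

/-- As `HaltsWithin`, for a time bound that may be infinite. -/
def HaltsBy : Regime → Prog → State → ℝ≥0∞ → Prop
  | .worstCase, p, s, T => ∀ ω : ℕ → Bool, ∃ (k : ℕ) (s' : State) (t : ℕ),
      Run p s ((List.range k).map ω) s' t ∧ (t : ℝ≥0∞) ≤ T
  | .expected, p, s, T => haltProb p s = 1 ∧ meanTime p s ≤ T

theorem haltsBy_natCast {r : Regime} {p : Prog} {s : State} {T : ℕ} :
    HaltsBy r p s T ↔ HaltsWithin r p s T := by
  cases r <;> simp [HaltsBy, HaltsWithin]

theorem haltsBy_top {r : Regime} {p : Prog} {s : State} : HaltsBy r p s ⊤ ↔ Halts r p s := by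
  cases r <;> simp [HaltsBy, Halts]

theorem HaltsBy.mono {r : Regime} {p : Prog} {s : State} {T T' : ℝ≥0∞} (h : HaltsBy r p s T)
    (hT : T ≤ T') : HaltsBy r p s T' := by
  cases r with
  | worstCase =>
    intro ω
    obtain ⟨k, s', t, h₁, h₂⟩ := h ω
    exact ⟨k, s', t, h₁, h₂.trans hT⟩
  | expected => exact ⟨h.1, h.2.trans hT⟩

theorem HaltsBy.halts {r : Regime} {p : Prog} {s : State} {T : ℝ≥0∞} (h : HaltsBy r p s T) :
    Halts r p s :=
  haltsBy_top.1 (h.mono le_top)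

/-- Halting and time bounds depend only on which bit strings halt and at what times. A simulation
that keeps the strings and delays the times by `c` therefore costs at most `c` more in either
regime. Branches, loop unfolding and renaming are all handled this way. -/
theorem HaltsBy.transfer {r : Regime} {p p' : Prog} {s s₀ : State} {T : ℝ≥0∞} (c : ℕ)
    (h : HaltsBy r p s₀ T)
    (hp : ∀ b t, (∃ s', Run p' s b s' t) ↔ ∃ t₀, t = c + t₀ ∧ ∃ s', Run p s₀ b s' t₀) :
    HaltsBy r p' s (c + T) := by
  cases r with
  | worstCase =>
    intro ω
    obtain ⟨k, s', t, h₁, h₂⟩ := h ω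
    obtain ⟨s'', h₃⟩ := (hp _ (c + t)).2 ⟨t, rfl, s', h₁⟩
    refine ⟨k, s'', c + t, h₃, ?_⟩
    push_cast
    gcongr
  | expected =>
    have hb : ∀ b : List Bool,
        (⨆ (s' : State) (t : ℕ) (_ : Run p' s b s' t), (2⁻¹ : ℝ≥0∞) ^ b.length) =
          ⨆ (s' : State) (t : ℕ) (_ : Run p s₀ b s' t), (2⁻¹ : ℝ≥0∞) ^ b.length := by
      intro b
      apply le_antisymm
      · refine iSup_le fun s' => iSup_le fun t => iSup_le fun h => ?_
        obtain ⟨t₀, -, s'', h'⟩ := (hp b t).1 ⟨s', h⟩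
        exact le_iSup_of_le s'' (le_iSup_of_le t₀ (le_iSup_of_le h' le_rfl))
      · refine iSup_le fun s' => iSup_le fun t => iSup_le fun h => ?_
        obtain ⟨s'', h'⟩ := (hp b (c + t)).2 ⟨t, rfl, s', h⟩
        exact le_iSup_of_le s'' (le_iSup_of_le (c + t) (le_iSup_of_le h' le_rfl))
    have hprob : haltProb p' s = haltProb p s₀ := tsum_congr hb
    refine ⟨hprob.trans h.1, ?_⟩
    calc meanTime p' s
        ≤ ∑' b : List Bool,
            ((c : ℝ≥0∞) * (⨆ (s' : State) (t : ℕ) (_ : Run p s₀ b s' t),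
              (2⁻¹ : ℝ≥0∞) ^ b.length) +
            ⨆ (s' : State) (t : ℕ) (_ : Run p s₀ b s' t),
              (t : ℝ≥0∞) * (2⁻¹ : ℝ≥0∞) ^ b.length) := by
          refine ENNReal.tsum_le_tsum fun b => ?_
          refine iSup_le fun s' => iSup_le fun t => iSup_le fun h => ?_
          obtain ⟨t₀, rfl, s'', h'⟩ := (hp b t).1 ⟨s', h⟩
          push_cast
          rw [add_mul]
          refine add_le_add (mul_le_mul_right ?_ _) ?_
          · exact le_iSup_of_le s'' (le_iSup_of_le t₀ (le_iSup_of_le h' le_rfl))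
          · exact le_iSup_of_le s'' (le_iSup_of_le t₀ (le_iSup_of_le h' le_rfl))
      _ = c * haltProb p s₀ + meanTime p s₀ := by
          rw [ENNReal.tsum_add, ENNReal.tsum_mul_left]
          rfl
      _ ≤ c + T := by
          rw [h.1, mul_one]
          exact add_le_add le_rfl h.2

/-- A run without coins excludes every other run, the empty string being a prefix of all strings. -/
theorem HaltsBy.of_run {r : Regime} {p : Prog} {s s' : State} {t : ℕ} (h : Run p s [] s' t) :
    HaltsBy r p s t := by
  cases r with
  | worstCase => exact fun ω => ⟨0, s', t, h, le_rfl⟩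
  | expected =>
    let x : Outcome p s := ⟨([], s', t), h⟩
    have hx : ∀ y : Outcome p s, y = x := fun y =>
      (Outcome.ext_bits (h.unique (c₁ := y.1.1) (c₂ := []) y.2 (by simp)).1).symm
    refine ⟨?_, ?_⟩
    · rw [haltProb_eq, tsum_eq_single x fun y hy => absurd (hx y) hy]
      simp [x]
    · rw [meanTime_eq, tsum_eq_single x fun y hy => absurd (hx y) hy]
      simp [x]

/-- The bound on `q` may grow linearly with the actual time of `p`. By linearity of expectation `a *
t` contributes at most `a * T₁`, so no pointwise bound on `t` is needed in the expected regime. -/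
theorem HaltsBy.seq {r : Regime} {p q : Prog} {s : State} {T₁ T₂ : ℝ≥0∞} (a : ℕ)
    (hp : HaltsBy r p s T₁)
    (hq : ∀ b s' t, Run p s b s' t → HaltsBy r q s' (a * t + T₂)) :
    HaltsBy r (.seq p q) s ((a + 1) * T₁ + T₂) := by
  cases r with
  | worstCase =>
    intro ω
    obtain ⟨k₁, s₁, t₁, h₁, ht₁⟩ := hp ω
    -- The second program reads the stream from the place where the first one stopped.
    obtain ⟨k₂, s₂, t₂, h₂, ht₂⟩ := hq _ _ _ h₁ fun i => ω (k₁ + i)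
    refine ⟨k₁ + k₂, s₂, t₁ + t₂, ?_, ?_⟩
    · rw [List.range_add, List.map_append, List.map_map]
      exact .seq h₁ h₂
    · push_cast
      calc (t₁ : ℝ≥0∞) + t₂ ≤ t₁ + (a * t₁ + T₂) := by gcongr
        _ = (a + 1) * t₁ + T₂ := by ring
        _ ≤ (a + 1) * T₁ + T₂ := by gcongr
  | expected =>
    have h₁ : ∀ x : Outcome p s, haltProb q x.1.2.1 = 1 := fun x => (hq _ _ _ x.2).1
    have h₂ : ∀ x : Outcome p s, meanTime q x.1.2.1 ≤ a * x.1.2.2 + T₂ :=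
      fun x => (hq _ _ _ x.2).2
    refine ⟨?_, ?_⟩
    · rw [haltProb_seq]
      simp only [h₁, mul_one]
      rw [← haltProb_eq, hp.1]
    · rw [meanTime_seq]
      calc _ ≤ ∑' x : Outcome p s, (((a : ℝ≥0∞) + 1) *
                (x.1.2.2 * (2⁻¹ : ℝ≥0∞) ^ x.1.1.length) +
                T₂ * (2⁻¹ : ℝ≥0∞) ^ x.1.1.length) := by
            refine ENNReal.tsum_le_tsum fun x => ?_
            rw [h₁, mul_one]
            calc _ ≤ (2⁻¹ : ℝ≥0∞) ^ x.1.1.length * (x.1.2.2 + (a * x.1.2.2 + T₂)) := by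
                  gcongr
                  exact h₂ x
              _ = _ := by ring
        _ = (a + 1) * meanTime p s + T₂ * haltProb p s := by
            rw [ENNReal.tsum_add, ENNReal.tsum_mul_left, ENNReal.tsum_mul_left, ← haltProb_eq,
              ← meanTime_eq]
        _ ≤ (a + 1) * T₁ + T₂ := by
            rw [hp.1, mul_one]
            gcongr
            exact hp.2

/-! ### A program logic for total correctness with time bounds -/

/-- Started in `s`, the program `p` halts within time `T`, and `Q` holds for the final state and the
running time of each of its runs. -/
def Triple (r : Regime) (p : Prog) (s : State) (T : ℝ≥0∞) (Q : State → ℕ → Prop) : Prop :=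
  HaltsBy r p s T ∧ ∀ b s' t, Run p s b s' t → Q s' t

theorem Triple.mono {r : Regime} {p : Prog} {s : State} {T T' : ℝ≥0∞} {Q Q' : State → ℕ → Prop}
    (h : Triple r p s T Q) (hT : T ≤ T') (hQ : ∀ s' t, Q s' t → Q' s' t) :
    Triple r p s T' Q' :=
  ⟨h.1.mono hT, fun b s' t hr => hQ s' t (h.2 b s' t hr)⟩

theorem Triple.conseq {r : Regime} {p : Prog} {s : State} {T T' : ℕ} {Q Q' : State → ℕ → Prop}
    (h : Triple r p s T Q) (hT : T ≤ T') (hQ : ∀ s' t, Q s' t → Q' s' t) :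
    Triple r p s T' Q' :=
  h.mono (by exact_mod_cast hT) hQ

/-- The bounds are extended reals so that the same rule serves when a part is only known to halt,
with bound `⊤`. -/
theorem Triple.seq_add {r : Regime} {p q : Prog} {s : State} {T₁ T₂ : ℝ≥0∞}
    {Q₁ Q₂ : State → ℕ → Prop} (hp : Triple r p s T₁ Q₁)
    (hq : ∀ s' t, Q₁ s' t → Triple r q s' T₂ Q₂) :
    Triple r (.seq p q) s (T₁ + T₂) fun s' _ => ∃ t, Q₂ s' t := by
  refine ⟨?_, ?_⟩
  · refine (HaltsBy.seq 0 hp.1 (T₂ := T₂) fun b s' t h => ?_).mono (by simp)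
    simpa using (hq s' t (hp.2 _ _ _ h)).1
  · intro b s' t h
    cases h with
    | seq h₁ h₂ => exact ⟨_, (hq _ _ (hp.2 _ _ _ h₁)).2 _ _ _ h₂⟩

theorem Triple.seq {r : Regime} {p q : Prog} {s : State} {T T₁ T₂ : ℕ}
    {Q₁ : State → ℕ → Prop} {Q₂ : State → Prop} (hp : Triple r p s T₁ Q₁)
    (hq : ∀ s' t, Q₁ s' t → Triple r q s' T₂ fun s' _ => Q₂ s') (hT : T₁ + T₂ ≤ T) :
    Triple r (.seq p q) s T fun s' _ => Q₂ s' :=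
  (hp.seq_add hq).mono (by exact_mod_cast hT) fun _ _ h => h.choose_spec

/-- The time bound of the second program may depend on the running time of the first. -/
theorem Triple.seq_of_time {r : Regime} {p q : Prog} {s : State} {T T₁ T₂ : ℕ} (a : ℕ)
    {Q₁ : State → ℕ → Prop} {Q₂ : State → Prop} (hp : Triple r p s T₁ Q₁)
    (hq : ∀ s' t, Q₁ s' t → Triple r q s' ((a * t + T₂ : ℕ) : ℝ≥0∞) fun s' _ => Q₂ s')
    (hT : (a + 1) * T₁ + T₂ ≤ T) :
    Triple r (.seq p q) s T fun s' _ => Q₂ s' := by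
  refine ⟨?_, ?_⟩
  · refine (HaltsBy.seq a hp.1 (T₂ := T₂) fun b s' t h => ?_).mono (by exact_mod_cast hT)
    simpa using (hq s' t (hp.2 _ _ _ h)).1
  · intro b s' t h
    cases h with
    | seq h₁ h₂ => exact (hq _ _ (hp.2 _ _ _ h₁)).2 _ _ _ h₂

theorem Triple.branch {r : Regime} {x : ℕ} {p q : Prog} {s : State} {T T₀ : ℕ}
    {Q : State → Prop} (hp : s.reg x ≠ 0 → Triple r p s T₀ fun s' _ => Q s')
    (hq : s.reg x = 0 → Triple r q s T₀ fun s' _ => Q s') (hT : 1 + (s.reg x).size + T₀ ≤ T) :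
    Triple r (.branch x p q) s T fun s' _ => Q s' := by
  by_cases hx : s.reg x = 0
  · refine ⟨((hq hx).1.transfer (p' := .branch x p q) (s := s) 1 ?_).mono ?_, ?_⟩
    · refine fun b t => ⟨?_, ?_⟩
      · rintro ⟨s', h⟩
        cases h with
        | branch_pos h _ => exact absurd hx h
        | branch_zero _ h => exact ⟨_, rfl, _, h⟩
      · rintro ⟨t, rfl, s', h⟩
        exact ⟨s', .branch_zero hx h⟩
    · exact_mod_cast (by omega : 1 + T₀ ≤ T)
    · intro b s' t h
      cases h with
      | branch_pos h _ => exact absurd hx h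
      | branch_zero _ h => exact (hq hx).2 _ _ _ h
  · refine ⟨((hp hx).1.transfer (p' := .branch x p q) (s := s) (1 + (s.reg x).size) ?_).mono ?_,
      ?_⟩
    · refine fun b t => ⟨?_, ?_⟩
      · rintro ⟨s', h⟩
        cases h with
        | branch_pos _ h => exact ⟨_, rfl, _, h⟩
        | branch_zero h _ => exact absurd h hx
      · rintro ⟨t, rfl, s', h⟩
        exact ⟨s', .branch_pos hx h⟩
    · exact_mod_cast hT
    · intro b s' t h
      cases h with
      | branch_pos _ h => exact (hp hx).2 _ _ _ h
      | branch_zero h _ => exact absurd h hx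

/-- The index of the invariant bounds the number of passes still to come. At index `0` the premise
`hp` would demand `0 = k' + 1`, so there the test register must be zero. -/
theorem Triple.loop {r : Regime} {x : ℕ} {p : Prog} {T T₀ : ℕ} {I : ℕ → State → Prop}
    (hI : ∀ k s, I k s → (s.reg x).size ≤ T₀)
    (hp : ∀ k s, I k s → s.reg x ≠ 0 →
      ∃ k', k = k' + 1 ∧ Triple r p s T fun s' _ => I k' s')
    {k : ℕ} {s : State} (hs : I k s) :
    Triple r (.loop x p) s ((k * (1 + T₀ + T) + 1 : ℕ) : ℝ≥0∞)
      fun s' _ => ∃ k', I k' s' ∧ s'.reg x = 0 := by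
  induction k generalizing s with
  | zero =>
    have hx : s.reg x = 0 := by
      by_contra hx
      obtain ⟨k', h, -⟩ := hp _ _ hs hx
      omega
    refine ⟨(HaltsBy.of_run (.loop_zero hx)).mono (by simp), ?_⟩
    intro b s' t h
    cases h with
    | loop_zero _ => exact ⟨0, hs, hx⟩
    | loop_pos h _ _ => exact absurd hx h
  | succ k ih =>
    by_cases hx : s.reg x = 0
    · refine ⟨(HaltsBy.of_run (.loop_zero hx)).mono (by simp), ?_⟩
      intro b s' t h
      cases h with
      | loop_zero _ => exact ⟨_, hs, hx⟩
      | loop_pos h _ _ => exact absurd hx h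
    · obtain ⟨k', h, hb⟩ := hp _ _ hs hx
      obtain rfl : k = k' := by omega
      -- Up to the cost of the test, a nonempty run of the loop is a run of the body in sequence
      -- with the loop, to which the sequence rule applies.
      have h₂ := Triple.seq (T := T + (k * (1 + T₀ + T) + 1)) hb
        (fun s' _ hs' => ih hs') le_rfl
      refine ⟨(h₂.1.transfer (p' := .loop x p) (s := s) (1 + (s.reg x).size) ?_).mono ?_, ?_⟩
      · refine fun b t => ⟨?_, ?_⟩
        · rintro ⟨s', h⟩
          cases h with
          | loop_zero h => exact absurd h hx
          | loop_pos _ h₁ h₂ => exact ⟨_, by rw [add_assoc], _, .seq h₁ h₂⟩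
        · rintro ⟨t, rfl, s', h⟩
          cases h with
          | seq h₁ h₂ => exact ⟨s', by rw [← add_assoc]; exact .loop_pos hx h₁ h₂⟩
      · have := hI _ _ hs
        have h' : 1 + (s.reg x).size + (T + (k * (1 + T₀ + T) + 1)) ≤
            (k + 1) * (1 + T₀ + T) + 1 := by
          rw [add_mul]; omega
        exact_mod_cast h'
      · intro b s' t h
        cases h with
        | loop_zero h => exact absurd h hx
        | loop_pos _ h₁ h₃ => exact h₂.2 _ _ _ (.seq h₁ h₃)

/-! ### Straight-line programs -/

/-- The program is a sequence of instructions without branches, loops and random bits. -/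
def Prog.IsStraight : Prog → Prop
  | .flip _ => False
  | .seq p q => p.IsStraight ∧ q.IsStraight
  | .branch _ _ _ => False
  | .loop _ _ => False
  | _ => True

/-- The effect of a straight-line program. -/
def Prog.exec : Prog → State → State
  | .const r x, s => s.setReg r x
  | .arith o r x y, s => s.setReg r (o.eval (s.reg x) (s.reg y))
  | .load r a i, s => s.setReg r (s.arr a (s.reg i))
  | .store a i r, s => s.setArr a (s.reg i) (s.reg r)
  | .seq p q, s => q.exec (p.exec s)
  | _, s => s

/-- The running time of a straight-line program. -/
def Prog.cost : Prog → State → ℕ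
  | .const _ x, _ => 1 + x.size
  | .arith _ _ x y, s => 1 + (s.reg x).size + (s.reg y).size
  | .load _ a i, s => 1 + (s.reg i).size + (s.arr a (s.reg i)).size
  | .store _ i r, s => 1 + (s.reg i).size + (s.reg r).size
  | .seq p q, s => p.cost s + q.cost (p.exec s)
  | _, _ => 1

theorem Prog.IsStraight.run {p : Prog} (hp : p.IsStraight) (s : State) :
    Run p s [] (p.exec s) (p.cost s) := by
  induction p generalizing s with
  | skip => exact .skip s
  | const r x => exact .const s r x
  | arith o r x y => exact .arith s o r x y
  | load r a i => exact .load s r a i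
  | store a i r => exact .store s a i r
  | flip r => exact hp.elim
  | seq p q ihp ihq => exact .seq (ihp hp.1 s) (ihq hp.2 _)
  | branch => exact hp.elim
  | loop => exact hp.elim

theorem Triple.straight {r : Regime} {p : Prog} (hp : p.IsStraight) {s : State} {T : ℕ}
    (hT : p.cost s ≤ T) : Triple r p s T fun s' _ => s' = p.exec s := by
  refine ⟨(HaltsBy.of_run (hp.run s)).mono (by exact_mod_cast hT), ?_⟩
  intro b s' t h
  exact ((hp.run s).unique (c₁ := b) (c₂ := []) h (by simp)).2.1.symm

/-! ### Growth of register contents -/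

theorem size_add_le (x y : ℕ) : (x + y).size ≤ 1 + x.size + y.size := by
  rw [Nat.size_le]
  have hx := Nat.lt_size_self x
  have hy := Nat.lt_size_self y
  have h₁ : (2 : ℕ) ^ x.size ≤ 2 ^ (x.size + y.size) := Nat.pow_le_pow_right two_pos (by omega)
  have h₂ : (2 : ℕ) ^ y.size ≤ 2 ^ (x.size + y.size) := Nat.pow_le_pow_right two_pos (by omega)
  rw [show 1 + x.size + y.size = (x.size + y.size) + 1 by omega, pow_succ]
  omega

theorem size_mul_le (x y : ℕ) : (x * y).size ≤ x.size + y.size := by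
  rw [Nat.size_le, pow_add]
  exact Nat.mul_lt_mul'' (Nat.lt_size_self x) (Nat.lt_size_self y)

theorem BinOp.size_eval_le (o : BinOp) (x y : ℕ) : (o.eval x y).size ≤ 1 + x.size + y.size := by
  cases o with
  | add => exact size_add_le x y
  | sub => exact (Nat.size_le_size (Nat.sub_le x y)).trans (by omega)
  | mul => exact (size_mul_le x y).trans (by omega)
  | div => exact (Nat.size_le_size (Nat.div_le_self x y)).trans (by omega)

theorem State.size_setReg_le {s : State} {r x t : ℕ} (h : x.size ≤ t) (i : ℕ) :
    ((s.setReg r x).reg i).size ≤ (s.reg i).size + t := by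
  by_cases hi : i = r
  · subst hi
    simp only [State.setReg, Function.update_self]
    omega
  · simp [State.setReg, Function.update_of_ne hi]

/-- Logarithmic cost charges every instruction at least the bit length of the number that it writes,
up to what the inputs to an operation already paid for. Array contents do not enter, because loading
a cell is charged with its length. -/
theorem Run.size_reg_le {p : Prog} {s s' : State} {b : List Bool} {t : ℕ} (h : Run p s b s' t)
    (i : ℕ) : (s'.reg i).size ≤ (s.reg i).size + t := by
  induction h with
  | skip | loop_zero => omega
  | const => exact State.size_setReg_le (by omega) i
  | arith s o r x y => exact State.size_setReg_le (o.size_eval_le _ _) i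
  | load => exact State.size_setReg_le (by omega) i
  | store s a j r => simp [State.setArr]
  | flip s r c => exact State.size_setReg_le (by cases c <;> simp [Bool.toNat]) i
  | seq => omega
  | branch_pos => omega
  | branch_zero => omega
  | loop_pos => omega

/-! ### Running a program on renamed registers and arrays -/

/-- The program with its registers and arrays renamed. -/
def Prog.rename (ρ α : ℕ → ℕ) : Prog → Prog
  | .skip => .skip
  | .const r x => .const (ρ r) x
  | .arith o r x y => .arith o (ρ r) (ρ x) (ρ y)
  | .load r a i => .load (ρ r) (α a) (ρ i)
  | .store a i r => .store (α a) (ρ i) (ρ r)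
  | .flip r => .flip (ρ r)
  | .seq p q => .seq (p.rename ρ α) (q.rename ρ α)
  | .branch r p q => .branch (ρ r) (p.rename ρ α) (q.rename ρ α)
  | .loop r p => .loop (ρ r) (p.rename ρ α)

theorem Prog.IsDeterministic.rename {p : Prog} (hp : p.IsDeterministic) (ρ α : ℕ → ℕ) :
    (p.rename ρ α).IsDeterministic := by
  induction p with
  | flip => exact hp
  | seq _ _ ih₁ ih₂ => exact ⟨ih₁ hp.1, ih₂ hp.2⟩
  | branch _ _ _ ih₁ ih₂ => exact ⟨ih₁ hp.1, ih₂ hp.2⟩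
  | loop _ _ ih => exact ih hp
  | _ => trivial

/-- The part of the memory that a renamed program sees. -/
def State.comap (ρ α : ℕ → ℕ) (s : State) : State where
  reg r := s.reg (ρ r)
  arr a := s.arr (α a)

section Rename

variable {ρ α : ℕ → ℕ}

theorem State.comap_setReg (hρ : ρ.Injective) (s : State) (r x : ℕ) :
    (s.setReg (ρ r) x).comap ρ α = (s.comap ρ α).setReg r x := by
  simp only [State.comap, State.setReg, State.mk.injEq, and_true]
  funext i
  by_cases h : i = r
  · simp [h]
  · simp [Function.update_of_ne h, Function.update_of_ne (hρ.ne h)]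

theorem State.comap_setArr (hα : α.Injective) (s : State) (a i x : ℕ) :
    (s.setArr (α a) i x).comap ρ α = (s.comap ρ α).setArr a i x := by
  simp only [State.comap, State.setArr, State.mk.injEq, true_and]
  funext j
  by_cases h : j = a
  · subst h; simp
  · simp [Function.update_of_ne h, Function.update_of_ne (hα.ne h)]

theorem Run.exists_rename (hρ : ρ.Injective) (hα : α.Injective) {p : Prog} {s₀ u : State}
    {b : List Bool} {t : ℕ} (h : Run p s₀ b u t) :
    ∀ s : State, s.comap ρ α = s₀ →
      ∃ s', Run (p.rename ρ α) s b s' t ∧ s'.comap ρ α = u := by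
  induction h with
  | skip => exact fun s hs => ⟨s, .skip s, hs⟩
  | const _ r x =>
    rintro s rfl
    exact ⟨_, .const s (ρ r) x, State.comap_setReg hρ _ _ _⟩
  | arith _ o r x y =>
    rintro s rfl
    exact ⟨_, .arith s o (ρ r) (ρ x) (ρ y), State.comap_setReg hρ _ _ _⟩
  | load _ r a i =>
    rintro s rfl
    exact ⟨_, .load s (ρ r) (α a) (ρ i), State.comap_setReg hρ _ _ _⟩
  | store _ a i r =>
    rintro s rfl
    exact ⟨_, .store s (α a) (ρ i) (ρ r), State.comap_setArr hα _ _ _ _⟩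
  | flip _ r c =>
    rintro s rfl
    exact ⟨_, .flip s (ρ r) c, State.comap_setReg hρ _ _ _⟩
  | seq _ _ ih₁ ih₂ =>
    rintro s rfl
    obtain ⟨s₁, h₁, rfl⟩ := ih₁ s rfl
    obtain ⟨s₂, h₂, rfl⟩ := ih₂ s₁ rfl
    exact ⟨s₂, .seq h₁ h₂, rfl⟩
  | branch_pos hr _ ih =>
    rintro s rfl
    obtain ⟨s₁, h₁, rfl⟩ := ih s rfl
    exact ⟨s₁, .branch_pos (r := ρ _) hr h₁, rfl⟩
  | branch_zero hr _ ih =>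
    rintro s rfl
    obtain ⟨s₁, h₁, rfl⟩ := ih s rfl
    exact ⟨s₁, .branch_zero (r := ρ _) hr h₁, rfl⟩
  | loop_zero hr =>
    rintro s rfl
    exact ⟨s, .loop_zero (r := ρ _) hr, rfl⟩
  | loop_pos hr _ _ ih₁ ih₂ =>
    rintro s rfl
    obtain ⟨s₁, h₁, rfl⟩ := ih₁ s rfl
    obtain ⟨s₂, h₂, rfl⟩ := ih₂ s₁ rfl
    exact ⟨s₂, .loop_pos (r := ρ _) hr h₁ h₂, rfl⟩

/-- The two memories agree outside the given registers and arrays. -/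
def State.AgreeOff (ρ α : ℕ → ℕ) (s s' : State) : Prop :=
  (∀ r ∉ Set.range ρ, s'.reg r = s.reg r) ∧ ∀ a ∉ Set.range α, s'.arr a = s.arr a

theorem State.AgreeOff.refl (s : State) : s.AgreeOff ρ α s :=
  ⟨fun _ _ => rfl, fun _ _ => rfl⟩

theorem State.AgreeOff.trans {s₁ s₂ s₃ : State} (h₁ : s₁.AgreeOff ρ α s₂)
    (h₂ : s₂.AgreeOff ρ α s₃) : s₁.AgreeOff ρ α s₃ :=
  ⟨fun r hr => (h₂.1 r hr).trans (h₁.1 r hr), fun a ha => (h₂.2 a ha).trans (h₁.2 a ha)⟩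

theorem State.AgreeOff.setReg (s : State) (r x : ℕ) : s.AgreeOff ρ α (s.setReg (ρ r) x) :=
  ⟨fun _ hi => Function.update_of_ne (fun h => hi ⟨r, h.symm⟩) _ _, fun _ _ => rfl⟩

theorem State.AgreeOff.setArr (s : State) (a i x : ℕ) :
    s.AgreeOff ρ α (s.setArr (α a) i x) :=
  ⟨fun _ _ => rfl, fun _ hj => Function.update_of_ne (fun h => hj ⟨a, h.symm⟩) _ _⟩

/-- The converse of `Run.exists_rename`: together they match the runs of a program and of its
renamed version, with equal bits and times. Injectivity prevents two names from sharing a cell, and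
the agreement outside the ranges protects the remaining memory. -/
theorem Run.of_rename (hρ : ρ.Injective) (hα : α.Injective) {p : Prog} {s s' : State}
    {b : List Bool} {t : ℕ} (h : Run (p.rename ρ α) s b s' t) :
    Run p (s.comap ρ α) b (s'.comap ρ α) t ∧ s.AgreeOff ρ α s' := by
  generalize hq : p.rename ρ α = q at h
  induction h generalizing p with
  | skip =>
    cases p <;> simp only [Prog.rename, reduceCtorEq] at hq
    exact ⟨.skip _, .refl _⟩
  | const s r x =>
    cases p <;> simp only [Prog.rename, reduceCtorEq, Prog.const.injEq] at hq
    obtain ⟨rfl, rfl⟩ := hq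
    rw [State.comap_setReg hρ]
    exact ⟨.const _ _ _, .setReg _ _ _⟩
  | arith s o r x y =>
    cases p <;> simp only [Prog.rename, reduceCtorEq, Prog.arith.injEq] at hq
    obtain ⟨rfl, rfl, rfl, rfl⟩ := hq
    rw [State.comap_setReg hρ]
    exact ⟨.arith (s.comap ρ α) _ _ _ _, .setReg _ _ _⟩
  | load s r a i =>
    cases p <;> simp only [Prog.rename, reduceCtorEq, Prog.load.injEq] at hq
    obtain ⟨rfl, rfl, rfl⟩ := hq
    rw [State.comap_setReg hρ]
    exact ⟨.load (s.comap ρ α) _ _ _, .setReg _ _ _⟩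
  | store s a i r =>
    cases p <;> simp only [Prog.rename, reduceCtorEq, Prog.store.injEq] at hq
    obtain ⟨rfl, rfl, rfl⟩ := hq
    rw [State.comap_setArr hα]
    exact ⟨.store (s.comap ρ α) _ _ _, .setArr _ _ _ _⟩
  | flip s r c =>
    cases p <;> simp only [Prog.rename, reduceCtorEq, Prog.flip.injEq] at hq
    subst hq
    rw [State.comap_setReg hρ]
    exact ⟨.flip _ _ _, .setReg _ _ _⟩
  | seq _ _ ih₁ ih₂ =>
    cases p <;> simp only [Prog.rename, reduceCtorEq, Prog.seq.injEq] at hq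
    exact ⟨.seq (ih₁ hq.1).1 (ih₂ hq.2).1, (ih₁ hq.1).2.trans (ih₂ hq.2).2⟩
  | branch_pos hr _ ih =>
    cases p <;> simp only [Prog.rename, reduceCtorEq, Prog.branch.injEq] at hq
    obtain ⟨rfl, h₁, h₂⟩ := hq
    exact ⟨.branch_pos (s := State.comap ρ α _) hr (ih h₁).1, (ih h₁).2⟩
  | branch_zero hr _ ih =>
    cases p <;> simp only [Prog.rename, reduceCtorEq, Prog.branch.injEq] at hq
    obtain ⟨rfl, h₁, h₂⟩ := hq
    exact ⟨.branch_zero (s := State.comap ρ α _) hr (ih h₂).1, (ih h₂).2⟩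
  | loop_zero hr =>
    cases p <;> simp only [Prog.rename, reduceCtorEq, Prog.loop.injEq] at hq
    obtain ⟨rfl, h₁⟩ := hq
    exact ⟨.loop_zero (s := State.comap ρ α _) hr, .refl _⟩
  | loop_pos hr _ _ ih₁ ih₂ =>
    cases p <;> simp only [Prog.rename, reduceCtorEq, Prog.loop.injEq] at hq
    obtain ⟨rfl, h₁⟩ := hq
    -- The remaining passes are a run of the whole renamed loop, so its preimage is again the whole
    -- loop.
    have h₂ := ih₂ (p := .loop _ _) (by rw [Prog.rename, h₁])
    exact ⟨.loop_pos (s := State.comap ρ α _) hr (ih₁ h₁).1 h₂.1, (ih₁ h₁).2.trans h₂.2⟩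

theorem Triple.rename (hρ : ρ.Injective) (hα : α.Injective) {r : Regime} {p : Prog} {s : State}
    {T : ℝ≥0∞} (h : HaltsBy r p (s.comap ρ α) T) :
    Triple r (p.rename ρ α) s T fun s' t =>
      (∃ b, Run p (s.comap ρ α) b (s'.comap ρ α) t) ∧ s.AgreeOff ρ α s' := by
  refine ⟨(h.transfer (p' := p.rename ρ α) (s := s) 0 ?_).mono (by simp), ?_⟩
  · refine fun b t => ⟨?_, ?_⟩
    · rintro ⟨s', h'⟩
      exact ⟨t, by simp, _, (h'.of_rename hρ hα).1⟩
    · rintro ⟨t, rfl, u, h'⟩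
      obtain ⟨s', h₁, -⟩ := h'.exists_rename hρ hα s rfl
      exact ⟨s', by simpa using h₁⟩
  · intro b s' t h'
    obtain ⟨h₁, h₂⟩ := h'.of_rename hρ hα
    exact ⟨⟨b, h₁⟩, h₂⟩

end Rename

/-! ### Two simulated memories next to twenty registers and two arrays of our own -/

/-- The registers of the two simulated memories. -/
def regOf (i : Bool) (r : ℕ) : ℕ := 2 * r + 20 + i.toNat

/-- The arrays of the two simulated memories. -/
def arrOf (i : Bool) (a : ℕ) : ℕ := 2 * a + 2 + i.toNat

theorem regOf_injective (i : Bool) : (regOf i).Injective := fun x y h => by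
  simp only [regOf] at h; omega

theorem arrOf_injective (i : Bool) : (arrOf i).Injective := fun x y h => by
  simp only [arrOf] at h; omega

/-- One of the two simulated memories. -/
def State.view (s : State) (i : Bool) : State := s.comap (regOf i) (arrOf i)

theorem State.view_setReg_own {s : State} {i : Bool} {r x : ℕ} (hr : r < 20) :
    (s.setReg r x).view i = s.view i := by
  simp only [State.view, State.comap, State.setReg, State.mk.injEq, and_true]
  funext j
  exact Function.update_of_ne (by simp only [regOf]; omega) _ _

theorem State.view_setArr_own {s : State} {i : Bool} {a j x : ℕ} (ha : a < 2) :
    (s.setArr a j x).view i = s.view i := by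
  simp only [State.view, State.comap, State.setArr, State.mk.injEq, true_and]
  funext k
  exact Function.update_of_ne (by simp only [arrOf]; omega) _ _

theorem State.view_setReg (s : State) (i : Bool) (r x : ℕ) :
    (s.setReg (regOf i r) x).view i = (s.view i).setReg r x :=
  State.comap_setReg (regOf_injective i) s r x

theorem State.view_setArr (s : State) (i : Bool) (a j x : ℕ) :
    (s.setArr (arrOf i a) j x).view i = (s.view i).setArr a j x :=
  State.comap_setArr (arrOf_injective i) s a j x

theorem State.view_call {s : State} {n : ℕ} {u v : Fin n} {i : Bool} :
    (s.call u v).view i = s.view i := by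
  rw [State.call, State.view_setReg_own (by norm_num), State.view_setReg_own (by norm_num)]

/-- Only the simulated memory `i` and the register `d` differ. -/
structure State.SameBut (i : Bool) (d : ℕ) (s s' : State) : Prop where
  reg : ∀ x < 20, x ≠ d → s'.reg x = s.reg x
  arr : ∀ a < 2, s'.arr a = s.arr a
  view : s'.view (!i) = s.view (!i)

/-- Only the simulated memory `i` differs. -/
structure State.SameOff (i : Bool) (s s' : State) : Prop where
  reg : ∀ x < 20, s'.reg x = s.reg x
  arr : ∀ a < 2, s'.arr a = s.arr a
  view : s'.view (!i) = s.view (!i)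

/-- The two simulated memories occupy names of opposite parity, above all names reserved for own
use. -/
theorem State.SameOff.of_agreeOff {s s' : State} {i : Bool}
    (h : s.AgreeOff (regOf i) (arrOf i) s') : s.SameOff i s' where
  reg x hx := h.1 x (by rintro ⟨j, hj⟩; simp only [regOf] at hj; omega)
  arr a ha := h.2 a (by rintro ⟨j, hj⟩; simp only [arrOf] at hj; omega)
  view := by
    simp only [State.view, State.comap, State.mk.injEq]
    constructor
    · funext x
      refine h.1 _ ?_
      rintro ⟨j, hj⟩
      cases i <;> simp [regOf] at hj <;> omega
    · funext x
      refine h.2 _ ?_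
      rintro ⟨j, hj⟩
      cases i <;> simp [arrOf] at hj <;> omega

theorem State.SameOff.trans {s₁ s₂ s₃ : State} {i : Bool} (h₁ : s₁.SameOff i s₂)
    (h₂ : s₂.SameOff i s₃) : s₁.SameOff i s₃ where
  reg x hx := (h₂.reg x hx).trans (h₁.reg x hx)
  arr a ha := (h₂.arr a ha).trans (h₁.arr a ha)
  view := h₂.view.trans h₁.view

theorem State.SameOff.setReg_own {s s' : State} {i : Bool} {d x : ℕ} (h : s.SameOff i s')
    (hd : d < 20) : s.SameBut i d (s'.setReg d x) where
  reg y hy hyd := (Function.update_of_ne hyd _ _).trans (h.reg y hy)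
  arr a ha := h.arr a ha
  view := (State.view_setReg_own hd).trans h.view

/-- Copies register `x` to register `r`. -/
def Prog.mov (r x : ℕ) : Prog := .seq (.const r 0) (.arith .add r x r)

theorem Prog.mov_isStraight (r x : ℕ) : (Prog.mov r x).IsStraight := ⟨trivial, trivial⟩

theorem Prog.exec_mov {r x : ℕ} (h : x ≠ r) (s : State) :
    (Prog.mov r x).exec s = s.setReg r (s.reg x) := by
  simp [Prog.mov, Prog.exec, State.setReg, BinOp.eval, Function.update_of_ne h]

theorem Prog.cost_mov {r x : ℕ} (h : x ≠ r) (s : State) :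
    (Prog.mov r x).cost s = 2 + (s.reg x).size := by
  simp [Prog.mov, Prog.cost, Prog.exec, State.setReg, Function.update_of_ne h]
  omega

theorem Triple.mov {r : Regime} {d x : ℕ} (h : x ≠ d) {s : State} {T : ℕ}
    (hT : 2 + (s.reg x).size ≤ T) :
    Triple r (.mov d x) s T fun s' _ => s' = s.setReg d (s.reg x) :=
  (Triple.straight (Prog.mov_isStraight d x) (by rwa [Prog.cost_mov h])).conseq le_rfl
    fun s' _ hs' => hs'.trans (Prog.exec_mov h s)

/-- Runs `p` on the simulated memory `i`, with arguments in the registers `x` and `y`. -/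
def Prog.callOn (i : Bool) (p : Prog) (x y : ℕ) : Prog :=
  .seq (.seq (.mov (regOf i 0) x) (.mov (regOf i 1) y)) (p.rename (regOf i) (arrOf i))

theorem Triple.set_args {r : Regime} {i : Bool} {x y : ℕ} (hx : x < 20) (hy : y < 20)
    {s : State} {T : ℕ} (hT : 4 + (s.reg x).size + (s.reg y).size ≤ T) :
    Triple r (.seq (.mov (regOf i 0) x) (.mov (regOf i 1) y)) s T fun s' _ =>
      s.SameOff i s' ∧ s'.view i = ((s.view i).setReg 0 (s.reg x)).setReg 1 (s.reg y) := by
  have h₀ : x ≠ regOf i 0 := by simp only [regOf]; omega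
  have h₁ : y ≠ regOf i 1 := by simp only [regOf]; omega
  have h₂ : y ≠ regOf i 0 := by simp only [regOf]; omega
  refine Triple.seq (T₁ := 2 + (s.reg x).size) (T₂ := 2 + (s.reg y).size)
    (Triple.mov h₀ le_rfl) ?_ (by omega)
  rintro s₁ - rfl
  have hy' : (s.setReg (regOf i 0) (s.reg x)).reg y = s.reg y := Function.update_of_ne h₂ _ _
  refine (Triple.mov h₁ (by rw [hy'])).conseq le_rfl ?_
  rintro s₂ - rfl
  rw [hy', State.view_setReg, State.view_setReg]
  exact ⟨.of_agreeOff (.trans (.setReg _ _ _) (.setReg _ _ _)), rfl⟩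

/-- The time `t₀` of the inner run is reported because it bounds the length of the answer that this
run leaves behind. -/
theorem Triple.callOn {r : Regime} {i : Bool} {p : Prog} {n x y T S : ℕ} {u v : Fin n}
    {s : State} (hx : x < 20) (hy : y < 20) (hu : s.reg x = u) (hv : s.reg y = v)
    (hS : ∀ w : Fin n, (w : ℕ).size ≤ S) (h : HaltsWithin r p ((s.view i).call u v) T) :
    Triple r (.callOn i p x y) s ((4 + 2 * S + T : ℕ) : ℝ≥0∞) fun s' t =>
      s.SameOff i s' ∧ ∃ b t₀, t₀ ≤ t ∧ Run p ((s.view i).call u v) b (s'.view i) t₀ := by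
  have h₁ := Triple.set_args (r := r) (i := i) (s := s) hx hy le_rfl
  have hsu := hS u
  have hsv := hS v
  rw [hu, hv] at h₁
  have hcall : ((s.view i).setReg 0 u).setReg 1 v = (s.view i).call u v := rfl
  rw [hcall] at h₁
  have h₂ : ∀ s', s.SameOff i s' ∧ s'.view i = (s.view i).call u v →
      Triple r (p.rename (regOf i) (arrOf i)) s' T fun s'' t =>
        s.SameOff i s'' ∧ ∃ b, Run p ((s.view i).call u v) b (s''.view i) t := by
    rintro s' ⟨hs', hv'⟩
    refine (Triple.rename (regOf_injective i) (arrOf_injective i) (T := T)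
      (haltsBy_natCast.2 ?_)).mono le_rfl ?_
    · rw [← hv'] at h
      exact h
    · rintro s'' t ⟨⟨b, hb⟩, ha⟩
      refine ⟨hs'.trans (.of_agreeOff ha), b, ?_⟩
      rw [← hv']
      exact hb
  refine ⟨(h₁.seq_add fun s' _ => h₂ s').1.mono ?_, ?_⟩
  · exact_mod_cast (by omega : 4 + (u : ℕ).size + (v : ℕ).size + T ≤ 4 + 2 * S + T)
  · intro b s' t hr
    cases hr with
    | seq k₁ k₂ =>
      obtain ⟨h₃, b', h₄⟩ := (h₂ _ (h₁.2 _ _ _ k₁)).2 _ _ _ k₂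
      exact ⟨h₃, b', _, by omega, h₄⟩

/-- Asks the simulated memory `i` a yes/no question and writes `a₁` to register `d` if the answer is
yes, `a₀` if it is no. -/
def Prog.ask (i : Bool) (p : Prog) (x y d a₁ a₀ : ℕ) : Prog :=
  .seq (.callOn i p x y) (.branch (regOf i 0) (.const d a₁) (.const d a₀))

theorem Triple.ask {r : Regime} {i : Bool} {p : Prog} {n x y d a₁ a₀ T S : ℕ} {u v : Fin n}
    {s : State} (hx : x < 20) (hy : y < 20) (hd : d < 20) (h₁ : a₁ ≤ 1) (h₀ : a₀ ≤ 1)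
    (hu : s.reg x = u) (hv : s.reg y = v) (hS : ∀ w : Fin n, (w : ℕ).size ≤ S)
    (h : HaltsWithin r p ((s.view i).call u v) T) :
    Triple r (.ask i p x y d a₁ a₀) s ((2 * T + 5 * S + 12 : ℕ) : ℝ≥0∞) fun s' _ =>
      s.SameBut i d s' ∧ (s'.reg d = if (s'.view i).reg 0 = 0 then a₀ else a₁) ∧
        ∃ b t, Run p ((s.view i).call u v) b (s'.view i) t := by
  -- The branch pays for the length of the answer, which nothing bounds except the running time of
  -- the query itself; hence a linear dependence on that time, with factor `1`.
  refine Triple.seq_of_time (T₂ := S + 4) 1 (Triple.callOn hx hy hu hv hS h) ?_ (by omega)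
  rintro s₁ t ⟨hs, b, t₀, ht, hr⟩
  have hsize : (s₁.reg (regOf i 0)).size ≤ S + t := by
    have := hr.size_reg_le 0
    have h2 : (((s.view i).call u v).reg 0).size ≤ S := by
      have : ((s.view i).call u v).reg 0 = u := by simp [State.call, State.setReg]
      rw [this]
      exact hS u
    change ((s₁.view i).reg 0).size ≤ _
    omega
  have hone : ∀ a, a ≤ 1 → a.size ≤ 1 := fun a ha => by interval_cases a <;> simp
  have key : ∀ a, a ≤ 1 → (a = if (s₁.view i).reg 0 = 0 then a₀ else a₁) →
      Triple r (.const d a) s₁ ((2 : ℕ) : ℝ≥0∞) fun s' _ => s.SameBut i d s' ∧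
        (s'.reg d = if (s'.view i).reg 0 = 0 then a₀ else a₁) ∧
        ∃ b t, Run p ((s.view i).call u v) b (s'.view i) t := by
    intro a ha ha'
    refine (Triple.straight (p := .const d a) trivial (T := 2) ?_).conseq le_rfl ?_
    · simpa [Prog.cost] using Nat.add_le_add_left (hone a ha) 1
    · rintro s' - rfl
      refine ⟨hs.setReg_own hd, ?_, b, t₀, ?_⟩
      · rw [Prog.exec, State.view_setReg_own hd, ← ha']
        simp [State.setReg]
      · rw [Prog.exec, State.view_setReg_own hd]
        exact hr
  refine Triple.branch (T₀ := 2) (fun hne => key a₁ h₁ ?_) (fun he => key a₀ h₀ ?_) (by omega)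
  · rw [if_neg]
    exact hne
  · rw [if_pos]
    exact he

/-! ### Calling a dynamic algorithm that provides access to a forest -/

/-- Time bounds and correctness of a dynamic algorithm on `n` vertices. -/
structure Oracle (r : Regime) (A : DynAlg Set.univ) (n : ℕ) (forest : State → SimpleGraph (Fin n))
    (T S : ℕ) : Prop where
  isForest : ∀ s G, A.Reach n s G → IsMaximalSpanningForest (forest s) G
  answer : ∀ s G, A.Reach n s G → ∀ (q : Query) (u v : Fin n), q.Legal G u v →
    ∀ (b : List Bool) (s' : State) (t : ℕ), Run (A.query ⟨q, trivial⟩) (s.call u v) b s' t →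
      forest s' = forest s ∧ q.Answer G (forest s) u v (s'.reg 0)
  update_time : ∀ s G, A.Reach n s G → ∀ (k : UpdateKind) (u v : Fin n), k.Legal G u v →
    HaltsWithin r (A.update k) (s.call u v) T
  query_time : ∀ s G, A.Reach n s G → ∀ (q : Query) (u v : Fin n), q.Legal G u v →
    HaltsWithin r (A.query ⟨q, trivial⟩) (s.call u v) T
  size_le : ∀ w : Fin n, (w : ℕ).size ≤ S
  le_two_pow : n ≤ 2 ^ S

section Calls

variable {r : Regime} {A : DynAlg Set.univ} {n : ℕ} {forest : State → SimpleGraph (Fin n)}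
  {T S : ℕ}

/-- The simulated memory `i` stands for the graph `G` and represents its spanning forest `F`. -/
structure Holds (A : DynAlg Set.univ) (forest : State → SimpleGraph (Fin n)) (i : Bool)
    (s : State) (G F : SimpleGraph (Fin n)) : Prop where
  reach : A.Reach n (s.view i) G
  forest_eq : forest (s.view i) = F

theorem Holds.congr {i : Bool} {s s' : State} {G F : SimpleGraph (Fin n)}
    (h : Holds A forest i s G F) (hs : s'.view i = s.view i) : Holds A forest i s' G F :=
  ⟨hs ▸ h.reach, hs ▸ h.forest_eq⟩

theorem Oracle.isForest_of_holds (hO : Oracle r A n forest T S) {i : Bool} {s : State}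
    {G F : SimpleGraph (Fin n)} (h : Holds A forest i s G F) : IsMaximalSpanningForest F G :=
  h.forest_eq ▸ hO.isForest _ _ h.reach

variable {i : Bool} {s : State} {G F : SimpleGraph (Fin n)} {x y d : ℕ} {u v : Fin n}

theorem Oracle.update (hO : Oracle r A n forest T S) (h : Holds A forest i s G F)
    {k : UpdateKind} (hk : k.Legal G u v) (hx : x < 20) (hy : y < 20)
    (hu : s.reg x = u) (hv : s.reg y = v) :
    Triple r (.callOn i (A.update k) x y) s ((4 + 2 * S + T : ℕ) : ℝ≥0∞) fun s' _ =>
      s.SameOff i s' ∧ ∃ F', Holds A forest i s' (k.apply G u v) F' := by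
  refine (Triple.callOn hx hy hu hv hO.size_le
    (hO.update_time _ _ h.reach k u v hk)).conseq le_rfl ?_
  rintro s' t ⟨hs, b, t₀, -, hr⟩
  -- Nothing relates the forest after an update to the one before; the witness is whatever the
  -- memory now represents.
  exact ⟨hs, _, .update h.reach hk hr, rfl⟩

/-- An admissible query leads to a reachable memory again and leaves the forest alone, so the same
`G` and `F` stay valid through any number of queries. -/
theorem Oracle.ask_query (hO : Oracle r A n forest T S) (h : Holds A forest i s G F)
    {q : Query} (hq : q.Legal G u v) {P : Prop} [Decidable P] {a₁ a₀ : ℕ}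
    (hP : ∀ a, q.Answer G F u v a → (a ≠ 0 ↔ P))
    (hx : x < 20) (hy : y < 20) (hd : d < 20) (h₁ : a₁ ≤ 1) (h₀ : a₀ ≤ 1)
    (hu : s.reg x = u) (hv : s.reg y = v) :
    Triple r (.ask i (A.query ⟨q, trivial⟩) x y d a₁ a₀) s
      ((2 * T + 5 * S + 12 : ℕ) : ℝ≥0∞) fun s' _ =>
      s.SameBut i d s' ∧ Holds A forest i s' G F ∧ s'.reg d = if P then a₁ else a₀ := by
  refine (Triple.ask hx hy hd h₁ h₀ hu hv hO.size_le
    (hO.query_time _ _ h.reach q u v hq)).conseq le_rfl ?_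
  rintro s' - ⟨hs, ha, b, t, hr⟩
  obtain ⟨h₂, h₃⟩ := hO.answer _ _ h.reach q u v hq _ _ _ hr
  rw [h.forest_eq] at h₂ h₃
  refine ⟨hs, ⟨.query h.reach hq hr, h₂⟩, ?_⟩
  rw [ha]
  have := hP _ h₃
  by_cases hp : P
  · rw [if_pos hp, if_neg (this.2 hp)]
  · rw [if_neg hp, if_pos (by by_contra hne; exact hp (this.1 hne))]

open Classical in
theorem Oracle.ask_connected (hO : Oracle r A n forest T S) (h : Holds A forest i s G F)
    {a₁ a₀ : ℕ} (hx : x < 20) (hy : y < 20) (hd : d < 20) (h₁ : a₁ ≤ 1) (h₀ : a₀ ≤ 1)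
    (hu : s.reg x = u) (hv : s.reg y = v) :
    Triple r (.ask i (A.query ⟨.connected, trivial⟩) x y d a₁ a₀) s
      ((2 * T + 5 * S + 12 : ℕ) : ℝ≥0∞) fun s' _ =>
      s.SameBut i d s' ∧ Holds A forest i s' G F ∧
        s'.reg d = if G.Reachable u v then a₁ else a₀ :=
  hO.ask_query h (q := .connected) trivial (fun _ h => h) hx hy hd h₁ h₀ hu hv

open Classical in
theorem Oracle.ask_forestEdge (hO : Oracle r A n forest T S) (h : Holds A forest i s G F)
    {a₁ a₀ : ℕ} (hx : x < 20) (hy : y < 20) (hd : d < 20) (h₁ : a₁ ≤ 1) (h₀ : a₀ ≤ 1)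
    (hu : s.reg x = u) (hv : s.reg y = v) :
    Triple r (.ask i (A.query ⟨.forestEdge, trivial⟩) x y d a₁ a₀) s
      ((2 * T + 5 * S + 12 : ℕ) : ℝ≥0∞) fun s' _ =>
      s.SameBut i d s' ∧ Holds A forest i s' G F ∧
        s'.reg d = if F.Adj u v then a₁ else a₀ :=
  hO.ask_query h (q := .forestEdge) trivial (fun _ h => h) hx hy hd h₁ h₀ hu hv

theorem Oracle.fetch_midpoint (hO : Oracle r A n forest T S) (h : Holds A forest i s G F)
    (huv : G.Reachable u v) (hx : x < 20) (hy : y < 20) (hd : d < 20)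
    (hu : s.reg x = u) (hv : s.reg y = v) :
    Triple r (.seq (.callOn i (A.query ⟨.midpoint, trivial⟩) x y) (.mov d (regOf i 0))) s
      ((6 + 3 * S + T : ℕ) : ℝ≥0∞) fun s' _ =>
      s.SameBut i d s' ∧ Holds A forest i s' G F ∧
        ∃ z : Fin n, s'.reg d = z ∧ IsMidpoint F u v z := by
  refine Triple.seq (T₂ := 2 + S) (Triple.callOn hx hy hu hv hO.size_le
    (hO.query_time _ _ h.reach .midpoint u v huv)) ?_ (by omega)
  rintro s₁ t ⟨hs, b, t₀, -, hr⟩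
  obtain ⟨h₂, z, h₃, h₄⟩ := hO.answer _ _ h.reach .midpoint u v huv _ _ _ hr
  rw [h.forest_eq] at h₂ h₄
  have hz : s₁.reg (regOf i 0) = z := h₃
  refine (Triple.mov (by simp only [regOf]; omega) (T := 2 + S) ?_).conseq le_rfl ?_
  · rw [hz]
    exact Nat.add_le_add_left (hO.size_le z) 2
  · rintro s' - rfl
    refine ⟨hs.setReg_own hd, Holds.congr ⟨.query (q := ⟨.midpoint, trivial⟩) h.reach huv hr, h₂⟩
      (State.view_setReg_own hd), z, ?_, h₄⟩
    rw [hz]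
    simp [State.setReg]

end Calls

/-! ### Maximal spanning forests under edge updates -/

section Graph

variable {n : ℕ} {F F' G H : SimpleGraph (Fin n)} {u v x y : Fin n}

theorem reachable_of_adj_imp (h : ∀ a b, G.Adj a b → H.Reachable a b) {a b : Fin n}
    (hab : G.Reachable a b) : H.Reachable a b := by
  obtain ⟨p⟩ := hab
  induction p with
  | nil => rfl
  | cons hadj _ ih => exact (h _ _ hadj).trans ih

theorem sup_edge_adj_iff {a b : Fin n} :
    (G ⊔ SimpleGraph.edge u v).Adj a b ↔
      G.Adj a b ∨ ((u = a ∧ v = b) ∨ (u = b ∧ v = a)) ∧ a ≠ b := by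
  rw [SimpleGraph.sup_adj, SimpleGraph.edge_adj]
  tauto

theorem reachable_sup_edge (G : SimpleGraph (Fin n)) (u v : Fin n) :
    (G ⊔ SimpleGraph.edge u v).Reachable u v := by
  by_cases h : u = v
  · rw [h]
  · exact (sup_edge_adj_iff.2 (.inr ⟨.inl ⟨rfl, rfl⟩, h⟩)).reachable

/-- A second crossing of the new edge either undoes the first or can be shortcut, so along a walk at
most one crossing has to be remembered. -/
theorem reachable_of_sup_edge {a b : Fin n} (h : (G ⊔ SimpleGraph.edge u v).Reachable a b) :
    G.Reachable a b ∨ (G.Reachable a u ∧ G.Reachable v b) ∨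
      (G.Reachable a v ∧ G.Reachable u b) := by
  obtain ⟨p⟩ := h
  induction p with
  | nil => exact .inl .rfl
  | cons hadj _ ih =>
    rcases sup_edge_adj_iff.1 hadj with h | ⟨⟨rfl, rfl⟩ | ⟨rfl, rfl⟩, -⟩
    · have := h.reachable
      rcases ih with h | ⟨h, h'⟩ | ⟨h, h'⟩
      · exact .inl (this.trans h)
      · exact .inr (.inl ⟨this.trans h, h'⟩)
      · exact .inr (.inr ⟨this.trans h, h'⟩)
    · rcases ih with h | ⟨h, h'⟩ | ⟨h, h'⟩
      · exact .inr (.inl ⟨.rfl, h⟩)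
      · exact .inl (h.symm.trans h')
      · exact .inl h'
    · rcases ih with h | ⟨h, h'⟩ | ⟨h, h'⟩
      · exact .inr (.inr ⟨.rfl, h⟩)
      · exact .inl h'
      · exact .inl (h.symm.trans h')

theorem deleteEdges_sup_edge (h : F.Adj u v) :
    F.deleteEdges {s(u, v)} ⊔ SimpleGraph.edge u v = F := by
  ext a b
  rw [sup_edge_adj_iff, SimpleGraph.deleteEdges_adj, Set.mem_singleton_iff, Sym2.eq_iff]
  constructor
  · rintro (h' | ⟨⟨rfl, rfl⟩ | ⟨rfl, rfl⟩, -⟩)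
    · exact h'.1
    · exact h
    · exact h.symm
  · intro h'
    have := h'.ne
    by_cases h₂ : (a = u ∧ b = v) ∨ (a = v ∧ b = u)
    · right
      refine ⟨?_, this⟩
      rcases h₂ with ⟨rfl, rfl⟩ | ⟨rfl, rfl⟩ <;> simp
    · exact .inl ⟨h', h₂⟩

theorem not_reachable_deleteEdges (hF : F.IsAcyclic) (h : F.Adj u v) :
    ¬ (F.deleteEdges {s(u, v)}).Reachable u v := by
  have := SimpleGraph.isAcyclic_iff_forall_adj_isBridge.1 hF h
  rw [SimpleGraph.isBridge_iff] at this
  exact this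

/-- Every edge of a forest is a bridge: if `F'` lacked an edge `ab` of `F`, it would lie in `F - ab`
and could not connect `a` with `b`. This is why the copy of the algorithm that runs on the explicit
forest represents exactly that forest. -/
theorem IsMaximalSpanningForest.eq_of_isAcyclic (h : IsMaximalSpanningForest F' F)
    (hF : F.IsAcyclic) : F' = F := by
  refine le_antisymm h.2.1 fun a b hab => ?_
  by_contra hn
  refine not_reachable_deleteEdges hF hab (((h.2.2 a b).2 hab.reachable).mono ?_)
  intro c d hcd
  rw [SimpleGraph.deleteEdges_adj, Set.mem_singleton_iff, Sym2.eq_iff]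
  refine ⟨h.2.1 hcd, ?_⟩
  rintro (⟨rfl, rfl⟩ | ⟨rfl, rfl⟩)
  · exact hn hcd
  · exact hn hcd.symm

theorem IsMaximalSpanningForest.insert_of_reachable (h : IsMaximalSpanningForest F G)
    (huv : G.Reachable u v) : IsMaximalSpanningForest F (G ⊔ SimpleGraph.edge u v) := by
  refine ⟨h.1, h.2.1.trans le_sup_left, fun a b => ⟨fun hab => ?_, fun hab => ?_⟩⟩
  · exact ((h.2.2 a b).1 hab).mono le_sup_left
  · refine (h.2.2 a b).2 (reachable_of_adj_imp (fun c d hcd => ?_) hab)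
    rcases sup_edge_adj_iff.1 hcd with h' | ⟨⟨rfl, rfl⟩ | ⟨rfl, rfl⟩, -⟩
    · exact h'.reachable
    · exact huv
    · exact huv.symm

theorem IsMaximalSpanningForest.insert_of_not_reachable (h : IsMaximalSpanningForest F G)
    (huv : ¬ G.Reachable u v) :
    IsMaximalSpanningForest (F ⊔ SimpleGraph.edge u v) (G ⊔ SimpleGraph.edge u v) := by
  refine ⟨h.1.sup_edge_of_not_reachable fun h' => huv ((h.2.2 u v).1 h'),
    sup_le_sup_right h.2.1 _, fun a b => ⟨fun hab => hab.mono (sup_le_sup_right h.2.1 _),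
    fun hab => reachable_of_adj_imp (fun c d hcd => ?_) hab⟩⟩
  rw [SimpleGraph.sup_adj] at hcd
  rcases hcd with hcd | hcd
  · exact ((h.2.2 c d).2 hcd.reachable).mono le_sup_left
  · exact (SimpleGraph.Adj.reachable hcd).mono le_sup_right

theorem deleteEdges_le_deleteEdges (h : F ≤ G) (u v : Fin n) :
    F.deleteEdges {s(u, v)} ≤ G.deleteEdges {s(u, v)} := by
  intro a b hab
  rw [SimpleGraph.deleteEdges_adj] at hab ⊢
  exact ⟨h hab.1, hab.2⟩

theorem IsMaximalSpanningForest.delete_of_not_adj (h : IsMaximalSpanningForest F G)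
    (huv : ¬ F.Adj u v) : IsMaximalSpanningForest F (G.deleteEdges {s(u, v)}) := by
  have hle : F ≤ G.deleteEdges {s(u, v)} := by
    intro a b hab
    rw [SimpleGraph.deleteEdges_adj, Set.mem_singleton_iff, Sym2.eq_iff]
    refine ⟨h.2.1 hab, ?_⟩
    rintro (⟨rfl, rfl⟩ | ⟨rfl, rfl⟩)
    · exact huv hab
    · exact huv hab.symm
  exact ⟨h.1, hle, fun a b => ⟨fun hab => hab.mono hle,
    fun hab => (h.2.2 a b).2 (hab.mono (SimpleGraph.deleteEdges_le _))⟩⟩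

theorem IsMaximalSpanningForest.reachable_of_deleteEdges (h : IsMaximalSpanningForest F G)
    (huv : F.Adj u v) {a b : Fin n} (hab : G.Reachable a b) :
    (F.deleteEdges {s(u, v)}).Reachable a b ∨
      ((F.deleteEdges {s(u, v)}).Reachable a u ∧ (F.deleteEdges {s(u, v)}).Reachable v b) ∨
      ((F.deleteEdges {s(u, v)}).Reachable a v ∧ (F.deleteEdges {s(u, v)}).Reachable u b) := by
  have hab' := (h.2.2 a b).2 hab
  rw [← deleteEdges_sup_edge huv] at hab'
  exact reachable_of_sup_edge hab'

theorem IsMaximalSpanningForest.delete_of_not_reachable (h : IsMaximalSpanningForest F G)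
    (huv : F.Adj u v) (hn : ¬ (G.deleteEdges {s(u, v)}).Reachable u v) :
    IsMaximalSpanningForest (F.deleteEdges {s(u, v)}) (G.deleteEdges {s(u, v)}) := by
  have hle := deleteEdges_le_deleteEdges h.2.1 u v
  refine ⟨h.1.anti (SimpleGraph.deleteEdges_le _), hle, fun a b =>
    ⟨fun hab => hab.mono hle, fun hab => ?_⟩⟩
  rcases h.reachable_of_deleteEdges huv (hab.mono (SimpleGraph.deleteEdges_le _)) with
    h' | ⟨h₁, h₂⟩ | ⟨h₁, h₂⟩
  · exact h'
  · exact absurd (((h₁.mono hle).symm.trans hab).trans (h₂.mono hle).symm) hn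
  · exact absurd (((h₂.mono hle).trans hab.symm).trans (h₁.mono hle)) hn

/-- An edge that leaves the component of `u` replaces the deleted edge `uv`. -/
theorem IsMaximalSpanningForest.replace (h : IsMaximalSpanningForest F G) (huv : F.Adj u v)
    (hxy : (G.deleteEdges {s(u, v)}).Adj x y)
    (hx : (F.deleteEdges {s(u, v)}).Reachable u x)
    (hy : ¬ (F.deleteEdges {s(u, v)}).Reachable u y) :
    IsMaximalSpanningForest (F.deleteEdges {s(u, v)} ⊔ SimpleGraph.edge x y)
      (G.deleteEdges {s(u, v)}) := by
  have hle := deleteEdges_le_deleteEdges h.2.1 u v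
  have hle' : F.deleteEdges {s(u, v)} ⊔ SimpleGraph.edge x y ≤ G.deleteEdges {s(u, v)} := by
    refine sup_le hle fun a b hab => ?_
    rw [SimpleGraph.edge_adj] at hab
    rcases hab with ⟨⟨rfl, rfl⟩ | ⟨rfl, rfl⟩, -⟩
    · exact hxy
    · exact hxy.symm
  refine ⟨?_, hle', fun a b => ⟨fun hab => hab.mono hle', fun hab => ?_⟩⟩
  · exact (h.1.anti (SimpleGraph.deleteEdges_le _)).sup_edge_of_not_reachable
      fun h' => hy (hx.trans h')
  · have hGuy : G.Reachable u y :=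
      (hx.mono (hle.trans (SimpleGraph.deleteEdges_le _))).trans
        (hxy.reachable.mono (SimpleGraph.deleteEdges_le _))
    -- In `G` the vertex `y` is connected with `u`, and this component of `F` falls into the parts
    -- of `u` and of `v`. As `y` is not in the first part, it is in the second, so `xy` joins the
    -- two.
    have hvy : (F.deleteEdges {s(u, v)}).Reachable v y := by
      rcases h.reachable_of_deleteEdges huv hGuy with h' | ⟨-, h'⟩ | ⟨-, h'⟩
      · exact absurd h' hy
      · exact h'
      · exact absurd h' hy
    have huv' : (F.deleteEdges {s(u, v)} ⊔ SimpleGraph.edge x y).Reachable u v :=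
      ((hx.mono le_sup_left).trans (reachable_sup_edge _ x y)).trans (hvy.mono le_sup_left).symm
    rcases h.reachable_of_deleteEdges huv (hab.mono (SimpleGraph.deleteEdges_le _)) with
      h' | ⟨h₁, h₂⟩ | ⟨h₁, h₂⟩
    · exact h'.mono le_sup_left
    · exact ((h₁.mono le_sup_left).trans huv').trans (h₂.mono le_sup_left)
    · exact ((h₁.mono le_sup_left).trans huv'.symm).trans (h₂.mono le_sup_left)

/-- There is a path of at most the given length. -/
def PathWithin (F : SimpleGraph (Fin n)) (x y : Fin n) (l : ℕ) : Prop :=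
  ∃ p : F.Walk x y, p.IsPath ∧ p.length ≤ l

theorem PathWithin.of_reachable (h : F.Reachable x y) : PathWithin F x y n := by
  obtain ⟨p, hp⟩ := h.exists_isPath
  have := hp.length_lt
  rw [Fintype.card_fin] at this
  exact ⟨p, hp, this.le⟩

theorem PathWithin.adj_of_one (h : PathWithin F x y 1) (hxy : x ≠ y) : F.Adj x y := by
  obtain ⟨p, -, hl⟩ := h
  refine p.adj_of_length_eq_one ?_
  have : p.length ≠ 0 := fun h0 => hxy (SimpleGraph.Walk.eq_of_length_eq_zero h0)
  omega

theorem PathWithin.reachable {l : ℕ} (h : PathWithin F x y l) : F.Reachable x y :=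
  ⟨h.choose⟩

/-- Paths in a forest are unique, so the path of known length is the one whose midpoint is given.
With length at most `2 * l`, even the half that is rounded up has at most `l` edges. -/
theorem PathWithin.midpoint {l : ℕ} {z : Fin n} (hF : F.IsAcyclic) (h : PathWithin F x y (2 * l))
    (hz : IsMidpoint F x y z) : PathWithin F x z l ∧ PathWithin F z y l := by
  obtain ⟨p, hp, hl⟩ := h
  obtain ⟨q, hq, hz⟩ := hz
  obtain rfl : p = q := congrArg Subtype.val ((hF.subsingleton_path x y).elim ⟨p, hp⟩ ⟨q, hq⟩)
  obtain ⟨m, hm₁, hm₂, rfl⟩ : ∃ m, m ≤ l ∧ p.length ≤ m + l ∧ z = p.getVert m := by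
    rcases hz with rfl | rfl
    · exact ⟨_, by omega, by omega, rfl⟩
    · exact ⟨_, by omega, by omega, rfl⟩
  refine ⟨⟨p.take m, hp.take m, ?_⟩, ⟨p.drop m, hp.drop m, ?_⟩⟩
  · rw [SimpleGraph.Walk.take_length]
    omega
  · rw [SimpleGraph.Walk.drop_length]
    omega

end Graph

/-! ### Lists of changes -/

/-- Identifies the forest recorded by `ReachOut` with the one that the program logic provides. -/
theorem Changes.unique {n : ℕ} {L : List (UpdateKind × ℕ × ℕ)} {F F₁ F₂ : SimpleGraph (Fin n)}
    (h₁ : Changes L F F₁) (h₂ : Changes L F F₂) : F₁ = F₂ := by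
  induction h₁ with
  | nil => cases h₂; rfl
  | @cons k u v L F F' h hL ih =>
    generalize hM : (k, (u : ℕ), (v : ℕ)) :: L = M at h₂
    cases h₂ with
    | nil => cases hM
    | @cons k' u' v' _ _ _ h' hL' =>
      simp only [List.cons.injEq, Prod.mk.injEq, Fin.val_inj] at hM
      obtain ⟨⟨rfl, rfl, rfl⟩, rfl⟩ := hM
      exact ih hL'

theorem Changes.single {n : ℕ} {k : UpdateKind} {u v : Fin n} {F : SimpleGraph (Fin n)}
    (h : k.Legal F u v) : Changes [(k, (u : ℕ), (v : ℕ))] F (k.apply F u v) :=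
  .cons h (.nil _)

theorem Changes.pair {n : ℕ} {k k' : UpdateKind} {u v x y : Fin n} {F : SimpleGraph (Fin n)}
    (h : k.Legal F u v) (h' : k'.Legal (k.apply F u v) x y) :
    Changes [(k, (u : ℕ), (v : ℕ)), (k', (x : ℕ), (y : ℕ))] F
      (k'.apply (k.apply F u v) x y) :=
  .cons h (.single h')

/-- Inserting the listed edges one after the other. -/
theorem Changes.insertions {n : ℕ} (M : List (Fin n × Fin n)) {H F : SimpleGraph (Fin n)}
    (hM : (M.map fun e => s(e.1, e.2)).Nodup)
    (hF : ∀ e, e ∈ F.edgeSet ↔ e ∈ H.edgeSet ∨ e ∈ M.map fun e => s(e.1, e.2))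
    (hH : ∀ e ∈ M.map (fun e => s(e.1, e.2)), e ∉ H.edgeSet) :
    Changes (M.map fun e => (UpdateKind.insert, (e.1 : ℕ), (e.2 : ℕ))) H F := by
  induction M generalizing H with
  | nil =>
    obtain rfl : F = H := SimpleGraph.edgeSet_inj.1 (Set.ext fun e => by simpa using hF e)
    exact .nil _
  | cons e M ih =>
    simp only [List.map_cons, List.nodup_cons] at hM
    have hne : e.1 ≠ e.2 := by
      have : s(e.1, e.2) ∈ F.edgeSet := (hF _).2 (.inr (by simp))
      exact SimpleGraph.Adj.ne this
    have hnH : s(e.1, e.2) ∉ H.edgeSet := hH _ (by simp)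
    have hedge : (UpdateKind.insert.apply H e.1 e.2).edgeSet = H.edgeSet ∪ {s(e.1, e.2)} := by
      rw [UpdateKind.apply, SimpleGraph.edgeSet_sup, SimpleGraph.edgeSet_edge_of_ne hne]
    refine .cons (k := .insert) ⟨hne, hnH⟩ (ih hM.2 (fun f => ?_) fun f hf => ?_)
    · rw [hF, hedge, List.map_cons, List.mem_cons, Set.mem_union, Set.mem_singleton_iff, or_assoc]
    · rw [hedge, Set.mem_union, Set.mem_singleton_iff, not_or]
      refine ⟨hH f (List.mem_cons_of_mem _ hf), ?_⟩
      rintro rfl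
      exact hM.1 hf

/-- A crude bound, but enough to keep the bit length of edge counters and addresses logarithmic in
`n`. -/
theorem Lists.length_le {n : ℕ} {L : List (Fin n × Fin n)} {G : SimpleGraph (Fin n)}
    (h : Lists L G) : L.length ≤ n * n := by
  have := (List.Nodup.of_map _ h.1).length_le_card
  simpa using this

/-! ### Writing the output -/

theorem State.output_congr {s s' : State} (h₀ : s'.reg 0 = s.reg 0) (h : s'.arr 0 = s.arr 0) :
    s'.output = s.output := by
  simp only [State.output, h₀, h]

theorem State.output_eq_nil {s : State} (h : s.reg 0 = 0) : s.output = [] := by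
  simp [State.output, h]

theorem State.length_output (s : State) : s.output.length = s.reg 0 := by
  simp [State.output]

/-- The entry of the output that stands for an update of the edge `xy`. -/
def UpdateKind.code : UpdateKind → ℕ
  | .insert => 1
  | .delete => 0

/-- Appends an entry to the output; its endpoints are in the registers `x` and `y`. -/
def Prog.emit (k : UpdateKind) (x y : ℕ) : Prog :=
  .seq (.const 9 3) <| .seq (.arith .mul 9 0 9) <| .seq (.const 10 k.code) <|
    .seq (.store 0 9 10) <| .seq (.const 10 1) <| .seq (.arith .add 9 9 10) <|
    .seq (.store 0 9 x) <| .seq (.arith .add 9 9 10) <| .seq (.store 0 9 y) (.arith .add 0 0 10)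

/-- What `Prog.emit` does to the memory. -/
structure State.Emitted (k : UpdateKind) (x y : ℕ) (s s' : State) : Prop where
  reg : ∀ z < 20, z ≠ 0 → z ≠ 9 → z ≠ 10 → s'.reg z = s.reg z
  count : s'.reg 0 = s.reg 0 + 1
  output : s'.output = s.output ++ [(k, s.reg x, s.reg y)]
  arr : ∀ a ≠ 0, s'.arr a = s.arr a
  view : ∀ i, s'.view i = s.view i

theorem Triple.emit {r : Regime} {k : UpdateKind} {x y Z T : ℕ} {s : State}
    (hx : x ≠ 9 ∧ x ≠ 10) (hy : y ≠ 9 ∧ y ≠ 10) (hZ : (3 * s.reg 0 + 2).size ≤ Z)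
    (hT : 25 + 7 * Z + (s.reg x).size + (s.reg y).size ≤ T) :
    Triple r (.emit k x y) s T fun s' _ => s.Emitted k x y s' := by
  have hsize : ∀ m, m ≤ 3 * s.reg 0 + 2 → m.size ≤ Z := fun m hm =>
    (Nat.size_le_size hm).trans hZ
  have h1 := hsize (s.reg 0) (by omega)
  have h2 := hsize (s.reg 0 * 3) (by omega)
  have h3 := hsize (s.reg 0 * 3 + 1) (by omega)
  have h4 := hsize (s.reg 0 * 3 + 1 + 1) (by omega)
  have hk : k.code.size ≤ 1 := by cases k <;> simp [UpdateKind.code]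
  have h5 : Nat.size 3 = 2 := by decide
  refine (Triple.straight (p := .emit k x y) ?_ ?_).conseq le_rfl ?_
  · simp [Prog.emit, Prog.IsStraight]
  · simp [Prog.emit, Prog.cost, Prog.exec, State.setReg, State.setArr, BinOp.eval,
      Function.update_of_ne hx.1, Function.update_of_ne hx.2, Function.update_of_ne hy.1,
      Function.update_of_ne hy.2, h5]
    omega
  · rintro s' - rfl
    refine ⟨?_, ?_, ?_, ?_, ?_⟩
    · intro z _ hz0 hz9 hz10
      simp [Prog.emit, Prog.exec, State.setReg, State.setArr, Function.update_of_ne hz0,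
        Function.update_of_ne hz9, Function.update_of_ne hz10]
    · simp [Prog.emit, Prog.exec, State.setReg, State.setArr, BinOp.eval]
    · simp only [Prog.emit, Prog.exec, State.setReg, State.setArr, BinOp.eval, State.output]
      simp only [ne_eq, not_false_eq_true, Function.update_self, Function.update_of_ne,
        OfNat.zero_ne_ofNat, hx, hy, Function.update_idem,
        Nat.reduceEqDiff]
      rw [List.range_succ, List.map_append, List.map_singleton]
      congr 1
      · refine List.map_congr_left fun j hj => ?_
        rw [List.mem_range] at hj
        -- The earlier entries of the output lie below the three cells that are written.
        have e : ∀ m, m < s.reg 0 * 3 → ∀ (f : ℕ → ℕ) (p q w : ℕ),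
            Function.update (Function.update (Function.update f (s.reg 0 * 3) p)
              (s.reg 0 * 3 + 1) q) (s.reg 0 * 3 + 1 + 1) w m = f m := by
          intro m hm f p q w
          rw [Function.update_of_ne (by omega), Function.update_of_ne (by omega),
            Function.update_of_ne (by omega)]
        rw [e _ (by omega), e _ (by omega), e _ (by omega)]
      · rw [mul_comm 3]
        have hne : s.reg 0 * 3 ≠ s.reg 0 * 3 + 1 + 1 := by omega
        cases k <;> simp [UpdateKind.code, hne]
    · intro a ha
      simp [Prog.emit, Prog.exec, State.setReg, State.setArr, Function.update_of_ne ha]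
    · intro i
      simp [Prog.emit, Prog.exec, State.view_setReg_own, State.view_setArr_own]

/-! ### Updates -/

section Updates

/-- Copies the arguments to the registers 2 and 3 and starts with an empty output. -/
def Prog.setup : Prog := .seq (.mov 2 0) (.seq (.mov 3 1) (.const 0 0))

/-- Insertion: keep the forest if the end points are connected, else insert the edge into it. -/
def insertProg (A : DynAlg Set.univ) : Prog :=
  .seq .setup <| .seq (.ask false (A.query ⟨.connected, trivial⟩) 2 3 4 1 0) <|
    .seq (.callOn false (A.update .insert) 2 3) <|
    .branch 4 .skip (.seq (.callOn true (A.update .insert) 2 3) (.emit .insert 2 3))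

/-- One step of the binary search for a path edge that leaves the component of the first vertex. -/
def searchStep (A : DynAlg Set.univ) : Prog :=
  .seq (.seq (.callOn false (A.query ⟨.midpoint, trivial⟩) 5 6) (.mov 8 (regOf false 0))) <|
    .seq (.ask true (A.query ⟨.connected, trivial⟩) 2 8 4 1 0) <|
    .seq (.branch 4 (.mov 5 8) (.mov 6 8)) <|
    .ask false (A.query ⟨.forestEdge, trivial⟩) 5 6 7 0 1

/-- The binary search, from the end points of the deleted edge, and the replacement. -/
def replaceProg (A : DynAlg Set.univ) : Prog :=
  .seq (.seq (.mov 5 2) (.mov 6 3)) <|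
    .seq (.ask false (A.query ⟨.forestEdge, trivial⟩) 5 6 7 0 1) <|
    .seq (.loop 7 (searchStep A)) <|
    .seq (.callOn true (A.update .insert) 5 6) (.emit .insert 5 6)

/-- Deletion: an edge of the forest is removed from it and replaced if possible. -/
def deleteProg (A : DynAlg Set.univ) : Prog :=
  .seq .setup <| .seq (.ask true (A.query ⟨.forestEdge, trivial⟩) 2 3 4 1 0) <|
    .seq (.callOn false (A.update .delete) 2 3) <|
    .branch 4
      (.seq (.callOn true (A.update .delete) 2 3) <| .seq (.emit .delete 2 3) <|
        .seq (.ask false (A.query ⟨.connected, trivial⟩) 2 3 4 1 0) <|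
        .branch 4 (replaceProg A) .skip)
      .skip

variable {r : Regime} {A : DynAlg Set.univ} {n : ℕ} {forest : State → SimpleGraph (Fin n)}
  {T S : ℕ} {s s₀ : State} {G F F' : SimpleGraph (Fin n)} {u v : Fin n}

/-- The memory of the algorithm: one simulated memory stands for the graph `G`, the other one for
its explicit maximal spanning forest `F`. -/
structure Inv (A : DynAlg Set.univ) (forest : State → SimpleGraph (Fin n)) (s : State)
    (G F : SimpleGraph (Fin n)) : Prop where
  graph : ∃ F', Holds A forest false s G F'
  tree : ∃ F', Holds A forest true s F F'
  isForest : IsMaximalSpanningForest F G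

/-- After an update that turns `G` into `G'`: the output leads to a forest for `G'`. -/
def Updated (A : DynAlg Set.univ) (forest : State → SimpleGraph (Fin n))
    (F G' : SimpleGraph (Fin n)) (s : State) : Prop :=
  s.reg 0 ≤ 2 ∧ ∃ F', Changes s.output F F' ∧ Inv A forest s G' F'

/-- The arguments have been copied and the output is empty. -/
structure Started (u v : Fin n) (s₀ s : State) : Prop where
  count : s.reg 0 = 0
  left : s.reg 2 = u
  right : s.reg 3 = v
  view : ∀ i, s.view i = s₀.view i

theorem Triple.setup (hS : ∀ w : Fin n, (w : ℕ).size ≤ S) :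
    Triple r .setup (s₀.call u v) ((5 + 2 * S : ℕ) : ℝ≥0∞) fun s _ => Started u v s₀ s := by
  have hu := hS u
  have hv := hS v
  refine (Triple.straight (p := .setup) ?_ ?_).conseq le_rfl ?_
  · simp [Prog.setup, Prog.mov, Prog.IsStraight]
  · simp [Prog.setup, Prog.mov, Prog.cost, Prog.exec, State.setReg, State.call]
    omega
  · rintro s' - rfl
    refine ⟨?_, ?_, ?_, ?_⟩
    · simp [Prog.setup, Prog.mov, Prog.exec, State.setReg, State.call, BinOp.eval]
    · simp [Prog.setup, Prog.mov, Prog.exec, State.setReg, State.call, BinOp.eval]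
    · simp [Prog.setup, Prog.mov, Prog.exec, State.setReg, State.call, BinOp.eval]
    · intro i
      simp [Prog.setup, Prog.mov, Prog.exec, State.view_setReg_own, State.view_call]

theorem Started.of_sameBut {i : Bool} {d : ℕ} {s₁ s₂ : State} (h : Started u v s₀ s₁)
    (hs : s₁.SameBut i d s₂) (h₀ : d ≠ 0) (h₂ : d ≠ 2) (h₃ : d ≠ 3) :
    s₂.reg 0 = 0 ∧ s₂.reg 2 = u ∧ s₂.reg 3 = v ∧ s₂.view (!i) = s₀.view (!i) :=
  ⟨(hs.reg 0 (by norm_num) h₀.symm).trans h.count, (hs.reg 2 (by norm_num) h₂.symm).trans h.left,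
    (hs.reg 3 (by norm_num) h₃.symm).trans h.right, hs.view.trans (h.view _)⟩

theorem Oracle.insert (hO : Oracle r A n forest T S) (h : Inv A forest s₀ G F)
    (hk : UpdateKind.insert.Legal G u v) :
    Triple r (insertProg A) (s₀.call u v) ((100 + 4 * T + 15 * S : ℕ) : ℝ≥0∞) fun s _ =>
      Updated A forest F (UpdateKind.insert.apply G u v) s := by
  obtain ⟨F₀, h₀⟩ := h.graph
  obtain ⟨F₁, h₁⟩ := h.tree
  refine Triple.seq (T₂ := 95 + 4 * T + 13 * S) (Triple.setup hO.size_le) ?_ (by omega)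
  rintro s₁ - hs₁
  refine Triple.seq (T₂ := 80 + 2 * T + 8 * S)
    (hO.ask_connected (h₀.congr (hs₁.view _)) (by norm_num) (by norm_num) (by norm_num) le_rfl
      zero_le_one hs₁.left hs₁.right) ?_ (by omega)
  rintro s₂ - ⟨hs₂, h₂, hans⟩
  obtain ⟨hs₂0, hs₂2, hs₂3, hs₂v⟩ := hs₁.of_sameBut hs₂ (by norm_num) (by norm_num) (by norm_num)
  refine Triple.seq (T₂ := 70 + T + 6 * S)
    (hO.update h₂ hk (by norm_num) (by norm_num) hs₂2 hs₂3) ?_ (by omega)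
  rintro s₃ - ⟨hs₃, F₃, h₃⟩
  have hs₃4 := (hs₃.reg 4 (by norm_num)).trans hans
  have hs₃0 := (hs₃.reg 0 (by norm_num)).trans hs₂0
  have hs₃2 := (hs₃.reg 2 (by norm_num)).trans hs₂2
  have hs₃3 := (hs₃.reg 3 (by norm_num)).trans hs₂3
  have h₁' : Holds A forest true s₃ F F₁ := h₁.congr (hs₃.view.trans hs₂v)
  refine Triple.branch (T₀ := 60 + T + 6 * S) (fun hne => ?_) (fun he => ?_) ?_
  · have hreach : G.Reachable u v := by
      by_contra hn
      rw [hs₃4, if_neg hn] at hne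
      exact hne rfl
    refine (Triple.straight (p := .skip) trivial (T := 1) le_rfl).conseq (by omega) ?_
    rintro s' - rfl
    refine ⟨by simp [hs₃0], F, ?_, ⟨F₃, h₃⟩, ⟨F₁, h₁'⟩, ?_⟩
    · rw [State.output_eq_nil hs₃0]
      exact .nil F
    · exact h.isForest.insert_of_reachable hreach
  · have hreach : ¬ G.Reachable u v := by
      intro hr
      rw [hs₃4, if_pos hr] at he
      exact one_ne_zero he
    have hF : UpdateKind.insert.Legal F u v :=
      ⟨hk.1, fun hadj => hreach ((h.isForest.2.2 u v).1 hadj.reachable)⟩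
    refine Triple.seq (T₂ := 50 + 2 * S)
      (hO.update h₁' hF (by norm_num) (by norm_num) hs₃2 hs₃3) ?_ (by omega)
    rintro s₄ - ⟨hs₄, F₄, h₄⟩
    have hs₄0 := (hs₄.reg 0 (by norm_num)).trans hs₃0
    have hs₄2 := (hs₄.reg 2 (by norm_num)).trans hs₃2
    have hs₄3 := (hs₄.reg 3 (by norm_num)).trans hs₃3
    have hu := hO.size_le u
    have hv := hO.size_le v
    -- The output is still empty, so the largest address is `2`, which has two bits.
    refine (Triple.emit (Z := 2) (T := 50 + 2 * S) (by norm_num) (by norm_num) ?_ ?_).conseq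
      le_rfl ?_
    · rw [hs₄0]; decide
    · rw [hs₄2, hs₄3]; omega
    · rintro s₅ - hs₅
      refine ⟨by rw [hs₅.count, hs₄0]; norm_num, _, ?_, ⟨F₃, ?_⟩, ⟨F₄, h₄.congr (hs₅.view _)⟩, ?_⟩
      · rw [hs₅.output, State.output_eq_nil hs₄0, hs₄2, hs₄3]
        exact .single hF
      · exact h₃.congr ((hs₅.view _).trans hs₄.view)
      · exact h.isForest.insert_of_not_reachable hreach
  · rw [hs₃4]
    split_ifs <;> simp <;> omega

/-- The state of the binary search with path length at most `2 ^ k`. -/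
def Searching (A : DynAlg Set.univ) (forest : State → SimpleGraph (Fin n))
    (G F F' : SimpleGraph (Fin n)) (u : Fin n) (s₀ : State) (k : ℕ) (s : State) : Prop :=
  ∃ x y : Fin n, s.reg 2 = u ∧ s.reg 5 = x ∧ s.reg 6 = y ∧ s.reg 0 = s₀.reg 0 ∧
    s.arr 0 = s₀.arr 0 ∧ Holds A forest false s G F' ∧ (∃ F'', Holds A forest true s F F'') ∧
    F.Reachable u x ∧ ¬ F.Reachable u y ∧ PathWithin F' x y (2 ^ k) ∧
    (s.reg 7 = 0 → F'.Adj x y) ∧ s.reg 7 ≤ 1 ∧ (s.reg 7 ≠ 0 → ¬ F'.Adj x y)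

/-- The midpoint replaces the end point on its own side of the cut. The new subpath still leaves the
component of `u`, and the bound on its length is halved. -/
theorem Oracle.search_step (hO : Oracle r A n forest T S) {k : ℕ}
    (h : Searching A forest G F F' u s₀ (k + 1) s) :
    Triple r (searchStep A) s ((40 + 5 * T + 14 * S : ℕ) : ℝ≥0∞) fun s' _ =>
      Searching A forest G F F' u s₀ k s' := by
  classical
  obtain ⟨x, y, h2, h5, h6, h0, ha, hG, ⟨F'', hF⟩, hx, hy, hp, -⟩ := h
  have hF' := hO.isForest_of_holds hG
  refine Triple.seq (T₂ := 34 + 4 * T + 11 * S)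
    (hO.fetch_midpoint hG ((hF'.2.2 x y).1 hp.reachable) (by norm_num) (by norm_num)
      (by norm_num) h5 h6) ?_ (by omega)
  rintro s₁ - ⟨hs₁, hG₁, z, h8, hz⟩
  have hF₁ : Holds A forest true s₁ F F'' := hF.congr hs₁.view
  have h2' := (hs₁.reg 2 (by norm_num) (by norm_num)).trans h2
  refine Triple.seq (T₂ := 22 + 2 * T + 6 * S)
    (hO.ask_connected hF₁ (by norm_num) (by norm_num) (by norm_num) le_rfl
      zero_le_one h2' h8) ?_ (by omega)
  rintro s₂ - ⟨hs₂, hF₂, h4⟩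
  have hG₂ : Holds A forest false s₂ G F' := hG₁.congr hs₂.view
  have keep : ∀ w < 20, w ≠ 8 → w ≠ 4 → s₂.reg w = s.reg w := fun w hw hw8 hw4 =>
    (hs₂.reg w hw hw4).trans (hs₁.reg w hw hw8)
  have h8' := (hs₂.reg 8 (by norm_num) (by norm_num)).trans h8
  have harr : s₂.arr 0 = s₀.arr 0 :=
    (hs₂.arr 0 (by norm_num)).trans ((hs₁.arr 0 (by norm_num)).trans ha)
  have hzS := hO.size_le z
  rw [pow_succ'] at hp
  obtain ⟨hp₁, hp₂⟩ := hp.midpoint hF'.1 hz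
  -- Either way the step ends by asking whether the new end points are adjacent in `F'`, which sets
  -- the loop flag to `0` if they are.
  have fin : ∀ (s₃ : State) (x y : Fin n), s₃.reg 2 = u → s₃.reg 5 = x → s₃.reg 6 = y →
      s₃.reg 0 = s₀.reg 0 → s₃.arr 0 = s₀.arr 0 → (∀ i, s₃.view i = s₂.view i) →
      F.Reachable u x → ¬ F.Reachable u y → PathWithin F' x y (2 ^ k) →
      Triple r (.ask false (A.query ⟨.forestEdge, trivial⟩) 5 6 7 0 1) s₃
        ((2 * T + 5 * S + 12 : ℕ) : ℝ≥0∞) fun s' _ => Searching A forest G F F' u s₀ k s' := by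
    intro s₃ x y k2 k5 k6 k0 ka hv hx hy hp
    refine (hO.ask_forestEdge (hG₂.congr (hv _)) (by norm_num) (by norm_num) (by norm_num)
      zero_le_one le_rfl k5 k6).conseq le_rfl ?_
    rintro s₄ - ⟨hs₄, hG₄, h7⟩
    refine ⟨x, y, (hs₄.reg 2 (by norm_num) (by norm_num)).trans k2,
      (hs₄.reg 5 (by norm_num) (by norm_num)).trans k5,
      (hs₄.reg 6 (by norm_num) (by norm_num)).trans k6,
      (hs₄.reg 0 (by norm_num) (by norm_num)).trans k0,
      (hs₄.arr 0 (by norm_num)).trans ka, hG₄, ⟨_, hF₂.congr (hs₄.view.trans (hv _))⟩,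
      hx, hy, hp, ?_⟩
    rw [h7]
    split_ifs with hadj <;> simp [hadj]
  have hmov : ∀ (s₃ : State) (d : ℕ), (d = 5 ∨ d = 6) → s₃ = s₂.setReg d (s₂.reg 8) →
      (∀ w, w ≠ d → s₃.reg w = s₂.reg w) ∧ s₃.reg d = z ∧ s₃.arr 0 = s₀.arr 0 ∧
        ∀ i, s₃.view i = s₂.view i := by
    rintro s₃ d hd rfl
    exact ⟨fun w hw => Function.update_of_ne hw _ _,
      (Function.update_self _ _ _).trans h8', harr,
      fun i => State.view_setReg_own (by omega)⟩
  -- The intermediate assertion remembers the answer that selected the branch, since this is what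
  -- tells the side of the midpoint.
  refine Triple.seq (T₁ := 4 + S) (T₂ := 2 * T + 5 * S + 12)
    (Q₁ := fun s₃ _ => (s₂.reg 4 ≠ 0 ∧ s₃ = s₂.setReg 5 (s₂.reg 8)) ∨
      (s₂.reg 4 = 0 ∧ s₃ = s₂.setReg 6 (s₂.reg 8))) ?_ ?_ (by omega)
  · refine Triple.branch (T₀ := 2 + S) (fun hne => ?_) (fun he => ?_) ?_
    · exact (Triple.mov (by norm_num) (by rw [h8']; omega)).conseq le_rfl
        fun s₃ _ h₃ => .inl ⟨hne, h₃⟩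
    · exact (Triple.mov (by norm_num) (by rw [h8']; omega)).conseq le_rfl
        fun s₃ _ h₃ => .inr ⟨he, h₃⟩
    · rw [h4]
      split_ifs <;> simp <;> omega
  · rintro s₃ - (⟨hne, h₃⟩ | ⟨he, h₃⟩)
    · obtain ⟨m₁, m₂, m₃, m₄⟩ := hmov s₃ 5 (.inl rfl) h₃
      refine fin s₃ z y ?_ m₂ ?_ ?_ m₃ m₄ ?_ hy hp₂
      · rw [m₁ _ (by norm_num), keep 2 (by norm_num) (by norm_num) (by norm_num), h2]
      · rw [m₁ _ (by norm_num), keep 6 (by norm_num) (by norm_num) (by norm_num), h6]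
      · rw [m₁ _ (by norm_num), keep 0 (by norm_num) (by norm_num) (by norm_num), h0]
      · by_contra hn
        rw [h4, if_neg hn] at hne
        exact hne rfl
    · obtain ⟨m₁, m₂, m₃, m₄⟩ := hmov s₃ 6 (.inr rfl) h₃
      refine fin s₃ x z ?_ ?_ m₂ ?_ m₃ m₄ hx ?_ hp₁
      · rw [m₁ _ (by norm_num), keep 2 (by norm_num) (by norm_num) (by norm_num), h2]
      · rw [m₁ _ (by norm_num), keep 5 (by norm_num) (by norm_num) (by norm_num), h5]
      · rw [m₁ _ (by norm_num), keep 0 (by norm_num) (by norm_num) (by norm_num), h0]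
      · intro hn
        rw [h4, if_pos hn] at he
        exact one_ne_zero he

theorem Oracle.search (hO : Oracle r A n forest T S) {k : ℕ}
    (h : Searching A forest G F F' u s₀ k s) :
    Triple r (.loop 7 (searchStep A)) s ((k * (42 + 5 * T + 14 * S) + 1 : ℕ) : ℝ≥0∞)
      fun s' _ => ∃ k', Searching A forest G F F' u s₀ k' s' ∧ s'.reg 7 = 0 := by
  refine (Triple.loop (T := 40 + 5 * T + 14 * S) (T₀ := 1)
    (I := Searching A forest G F F' u s₀) ?_ ?_ h).conseq
    (le_of_eq (by ring)) fun _ _ => id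
  · rintro k s ⟨x, y, -, -, -, -, -, -, -, -, -, -, -, h7, -⟩
    exact (Nat.size_le_size h7).trans (by simp)
  · intro k s hs hne
    cases k with
    -- The end points lie on different sides and are thus distinct; a path of at most one edge
    -- between them is an edge of `F'`, contrary to the flag.
    | zero =>
      obtain ⟨x, y, -, -, -, -, -, -, -, hx, hy, hp, -, -, h7⟩ := hs
      refine absurd (hp.adj_of_one ?_) (h7 hne)
      rintro rfl
      exact hy hx
    | succ k => exact ⟨k, rfl, hO.search_step hs⟩

/-- Here `F'` is the first copy's forest for the graph after the deletion, so every edge of its path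
from `u` to `v` is available as a replacement; one that leaves the component of `u` in `F₀ - uv` is
wanted. -/
theorem Oracle.replace (hO : Oracle r A n forest T S) {F₀ : SimpleGraph (Fin n)}
    (hF₀ : IsMaximalSpanningForest F₀ G) (huv : F₀.Adj u v)
    (hG : Holds A forest false s (UpdateKind.delete.apply G u v) F')
    (hF : ∃ F'', Holds A forest true s (UpdateKind.delete.apply F₀ u v) F'')
    (hreach : (UpdateKind.delete.apply G u v).Reachable u v)
    (h2 : s.reg 2 = u) (h3 : s.reg 3 = v) (h0 : s.reg 0 = 1)
    (hout : s.output = [(.delete, (u : ℕ), (v : ℕ))]) :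
    Triple r (replaceProg A) s
      ((100 + 3 * T + 11 * S + S * (42 + 5 * T + 14 * S) : ℕ) : ℝ≥0∞) fun s' _ =>
      Updated A forest F₀ (UpdateKind.delete.apply G u v) s' := by
  classical
  have hu := hO.size_le u
  have hv := hO.size_le v
  have hF' := hO.isForest_of_holds hG
  refine Triple.seq (T₁ := 4 + 2 * S)
    (T₂ := 96 + 3 * T + 9 * S + S * (42 + 5 * T + 14 * S))
    (Triple.straight (p := .seq (.mov 5 2) (.mov 6 3)) ?_ ?_) ?_ (by omega)
  · simp [Prog.mov, Prog.IsStraight]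
  · simp [Prog.mov, Prog.cost, Prog.exec, State.setReg, h2, h3]
    omega
  rintro s₁ - hs₁
  have k : (∀ w, w ≠ 5 → w ≠ 6 → s₁.reg w = s.reg w) ∧ s₁.reg 5 = u ∧ s₁.reg 6 = v ∧
      s₁.arr = s.arr ∧ ∀ i, s₁.view i = s.view i := by
    subst hs₁
    refine ⟨fun w hw5 hw6 => ?_, ?_, ?_, ?_, fun i => ?_⟩
    · simp [Prog.exec, Prog.mov, State.setReg, Function.update_of_ne hw5, Function.update_of_ne hw6]
    · simp [Prog.exec, Prog.mov, State.setReg, BinOp.eval, h2]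
    · simp [Prog.exec, Prog.mov, State.setReg, BinOp.eval, h3]
    · simp [Prog.exec, Prog.mov, State.setReg]
    · simp [Prog.exec, Prog.mov, State.view_setReg_own]
  obtain ⟨kreg, k5, k6, karr, kview⟩ := k
  clear hs₁
  refine Triple.seq (T₂ := 84 + T + 4 * S + S * (42 + 5 * T + 14 * S))
    (hO.ask_forestEdge (hG.congr (kview _)) (by norm_num) (by norm_num) (by norm_num)
      zero_le_one le_rfl k5 k6) ?_ (by omega)
  rintro s₂ - ⟨hs₂, hG₂, h7⟩
  have hsearch : Searching A forest (UpdateKind.delete.apply G u v)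
      (UpdateKind.delete.apply F₀ u v) F' u s S s₂ := by
    refine ⟨u, v, ?_, ?_, ?_, ?_, ?_, hG₂, ?_, .rfl, not_reachable_deleteEdges hF₀.1 huv, ?_, ?_⟩
    · rw [hs₂.reg _ (by norm_num) (by norm_num), kreg _ (by norm_num) (by norm_num), h2]
    · rw [hs₂.reg _ (by norm_num) (by norm_num), k5]
    · rw [hs₂.reg _ (by norm_num) (by norm_num), k6]
    · rw [hs₂.reg _ (by norm_num) (by norm_num), kreg _ (by norm_num) (by norm_num)]
    · rw [hs₂.arr _ (by norm_num), karr]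
    · exact hF.imp fun _ h => h.congr (hs₂.view.trans (kview _))
    -- The whole path from `u` to `v` has at most `n ≤ 2 ^ S` edges, so the search starts at level
    -- `S`.
    · obtain ⟨p, hp, hl⟩ := PathWithin.of_reachable ((hF'.2.2 u v).2 hreach)
      exact ⟨p, hp, hl.trans hO.le_two_pow⟩
    · rw [h7]
      split_ifs with hadj <;> simp [hadj]
  refine Triple.seq (T₂ := 80 + T + 4 * S) (hO.search hsearch) ?_ (by omega)
  rintro s₃ - ⟨k', ⟨x, y, -, h5, h6, h30, h3a, hG₃, ⟨F₃, hF₃⟩, hx, hy, -, hadj, -⟩, h37⟩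
  have hxy := hadj h37
  -- The edge is absent from `F₀ - uv`, since otherwise `y` would lie in the component of `u`.
  have hlegal : UpdateKind.insert.Legal (UpdateKind.delete.apply F₀ u v) x y := by
    refine ⟨hxy.ne, fun h => hy (hx.trans h.reachable)⟩
  refine Triple.seq (T₂ := 76 + 2 * S)
    (hO.update hF₃ hlegal (by norm_num) (by norm_num) h5 h6) ?_ (by omega)
  rintro s₄ - ⟨hs₄, F₄, hF₄⟩
  have h40 : s₄.reg 0 = 1 := by rw [hs₄.reg _ (by norm_num), h30, h0]
  have h45 := (hs₄.reg 5 (by norm_num)).trans h5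
  have h46 := (hs₄.reg 6 (by norm_num)).trans h6
  have hxS := hO.size_le x
  have hyS := hO.size_le y
  -- The deletion has already been written, so the largest address is `3 * 1 + 2 = 5`, which has
  -- three bits.
  refine (Triple.emit (Z := 3) (T := 76 + 2 * S) (by norm_num) (by norm_num) ?_ ?_).conseq
    le_rfl ?_
  · rw [h40]; decide
  · rw [h45, h46]; omega
  · rintro s₅ - hs₅
    refine ⟨by rw [hs₅.count, h40], _, ?_, ⟨F', ?_⟩, ⟨F₄, hF₄.congr (hs₅.view _)⟩,
      hF₀.replace huv (hF'.2.1 hxy) hx hy⟩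
    · rw [hs₅.output, State.output_congr (hs₄.reg 0 (by norm_num)) (hs₄.arr 0 (by norm_num)),
        State.output_congr h30 h3a, hout, h45, h46]
      exact .pair (k := .delete) huv hlegal
    · exact hG₃.congr ((hs₅.view _).trans hs₄.view)

theorem Oracle.delete (hO : Oracle r A n forest T S) (h : Inv A forest s₀ G F)
    (hk : UpdateKind.delete.Legal G u v) :
    Triple r (deleteProg A) (s₀.call u v)
      ((250 + 9 * T + 29 * S + S * (42 + 5 * T + 14 * S) : ℕ) : ℝ≥0∞) fun s _ =>
      Updated A forest F (UpdateKind.delete.apply G u v) s := by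
  classical
  obtain ⟨F₀, h₀⟩ := h.graph
  obtain ⟨F₁, h₁⟩ := h.tree
  -- The second copy runs on an acyclic graph, so its represented forest is the explicit one and its
  -- forest-edge queries decide membership in `F`.
  obtain rfl : F₁ = F := (hO.isForest_of_holds h₁).eq_of_isAcyclic h.isForest.1
  have hu := hO.size_le u
  have hv := hO.size_le v
  refine Triple.seq (T₂ := 245 + 9 * T + 27 * S + S * (42 + 5 * T + 14 * S))
    (Triple.setup hO.size_le) ?_ (by omega)
  rintro s₁ - hs₁
  refine Triple.seq (T₂ := 230 + 7 * T + 22 * S + S * (42 + 5 * T + 14 * S))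
    (hO.ask_forestEdge (h₁.congr (hs₁.view _)) (by norm_num) (by norm_num) (by norm_num) le_rfl
      zero_le_one hs₁.left hs₁.right) ?_ (by omega)
  rintro s₂ - ⟨hs₂, h₂, hans⟩
  obtain ⟨hs₂0, hs₂2, hs₂3, hs₂v⟩ := hs₁.of_sameBut hs₂ (by norm_num) (by norm_num) (by norm_num)
  refine Triple.seq (T₂ := 225 + 6 * T + 20 * S + S * (42 + 5 * T + 14 * S))
    (hO.update (h₀.congr hs₂v) hk (by norm_num) (by norm_num) hs₂2 hs₂3) ?_ (by omega)
  rintro s₃ - ⟨hs₃, F₃, h₃⟩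
  have hs₃4 := (hs₃.reg 4 (by norm_num)).trans hans
  have hs₃0 := (hs₃.reg 0 (by norm_num)).trans hs₂0
  have hs₃2 := (hs₃.reg 2 (by norm_num)).trans hs₂2
  have hs₃3 := (hs₃.reg 3 (by norm_num)).trans hs₂3
  have h₂' : Holds A forest true s₃ F₁ F₁ := h₂.congr hs₃.view
  refine Triple.branch (T₀ := 223 + 6 * T + 20 * S + S * (42 + 5 * T + 14 * S))
    (fun hne => ?_) (fun he => ?_) ?_
  · have hadj : F₁.Adj u v := by
      by_contra hn
      rw [hs₃4, if_neg hn] at hne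
      exact hne rfl
    -- The second copy learns of the deletion before the search, so that its connectivity queries
    -- refer to `F - uv`.
    refine Triple.seq (T₂ := 219 + 5 * T + 18 * S + S * (42 + 5 * T + 14 * S))
      (hO.update (k := .delete) h₂' hadj (by norm_num) (by norm_num) hs₃2 hs₃3) ?_ (by omega)
    rintro s₄ - ⟨hs₄, F₄, h₄⟩
    have hs₄0 := (hs₄.reg 0 (by norm_num)).trans hs₃0
    have hs₄2 := (hs₄.reg 2 (by norm_num)).trans hs₃2
    have hs₄3 := (hs₄.reg 3 (by norm_num)).trans hs₃3
    refine Triple.seq (T₁ := 39 + 2 * S)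
      (T₂ := 180 + 5 * T + 16 * S + S * (42 + 5 * T + 14 * S))
      (Triple.emit (Z := 2) (by norm_num) (by norm_num) ?_ ?_) ?_ (by omega)
    · rw [hs₄0]; decide
    · rw [hs₄2, hs₄3]; omega
    rintro s₅ - hs₅
    have hs₅0 : s₅.reg 0 = 1 := by rw [hs₅.count, hs₄0]
    have hs₅2 := (hs₅.reg 2 (by norm_num) (by norm_num) (by norm_num) (by norm_num)).trans hs₄2
    have hs₅3 := (hs₅.reg 3 (by norm_num) (by norm_num) (by norm_num) (by norm_num)).trans hs₄3
    have hs₅o : s₅.output = [(.delete, (u : ℕ), (v : ℕ))] := by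
      rw [hs₅.output, State.output_eq_nil hs₄0, hs₄2, hs₄3]
      rfl
    have h₅ : Holds A forest false s₅ (UpdateKind.delete.apply G u v) F₃ :=
      h₃.congr ((hs₅.view _).trans hs₄.view)
    refine Triple.seq (T₂ := 168 + 3 * T + 11 * S + S * (42 + 5 * T + 14 * S))
      (hO.ask_connected h₅ (by norm_num) (by norm_num) (by norm_num) le_rfl
        zero_le_one hs₅2 hs₅3) ?_ (by omega)
    rintro s₆ - ⟨hs₆, h₆, hans₆⟩
    have hs₆0 := (hs₆.reg 0 (by norm_num) (by norm_num)).trans hs₅0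
    have hs₆2 := (hs₆.reg 2 (by norm_num) (by norm_num)).trans hs₅2
    have hs₆3 := (hs₆.reg 3 (by norm_num) (by norm_num)).trans hs₅3
    have hs₆o : s₆.output = [(.delete, (u : ℕ), (v : ℕ))] :=
      (State.output_congr (hs₆.reg 0 (by norm_num) (by norm_num))
        (hs₆.arr 0 (by norm_num))).trans hs₅o
    have h₆' : Holds A forest true s₆ (UpdateKind.delete.apply F₁ u v) F₄ :=
      h₄.congr (hs₆.view.trans (hs₅.view _))
    refine Triple.branch (T₀ := 166 + 3 * T + 11 * S + S * (42 + 5 * T + 14 * S))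
      (fun hne₆ => ?_) (fun he₆ => ?_) ?_
    · have hreach : (UpdateKind.delete.apply G u v).Reachable u v := by
        by_contra hn
        rw [hans₆, if_neg hn] at hne₆
        exact hne₆ rfl
      exact (hO.replace h.isForest hadj h₆ ⟨_, h₆'⟩ hreach hs₆2 hs₆3 hs₆0 hs₆o).conseq
        (by omega) fun _ _ => id
    · have hreach : ¬ (UpdateKind.delete.apply G u v).Reachable u v := by
        intro hr
        rw [hans₆, if_pos hr] at he₆
        exact one_ne_zero he₆
      refine (Triple.straight (p := .skip) trivial (T := 1) le_rfl).conseq (by omega) ?_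
      rintro s' - rfl
      refine ⟨by simp [hs₆0], _, ?_, ⟨F₃, h₆⟩, ⟨F₄, h₆'⟩, ?_⟩
      · rw [hs₆o]
        exact .single (k := .delete) hadj
      · exact h.isForest.delete_of_not_reachable hadj hreach
    · rw [hans₆]
      split_ifs <;> simp <;> omega
  · have hadj : ¬ F₁.Adj u v := by
      intro hr
      rw [hs₃4, if_pos hr] at he
      exact one_ne_zero he
    refine (Triple.straight (p := .skip) trivial (T := 1) le_rfl).conseq (by omega) ?_
    rintro s' - rfl
    refine ⟨by simp [hs₃0], F₁, ?_, ⟨F₃, h₃⟩, ⟨F₁, h₂'⟩, ?_⟩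
    · rw [State.output_eq_nil hs₃0]
      exact .nil F₁
    · exact h.isForest.delete_of_not_adj hadj
  · rw [hs₃4]
    split_ifs <;> simp <;> omega

open Classical in
theorem Oracle.query (hO : Oracle r A n forest T S) (h : Inv A forest s₀ G F) (u v : Fin n) :
    Triple r (.ask false (A.query ⟨.connected, trivial⟩) 0 1 0 1 0) (s₀.call u v)
      ((2 * T + 5 * S + 12 : ℕ) : ℝ≥0∞) fun s' _ =>
      Inv A forest s' G F ∧ s'.reg 0 = if G.Reachable u v then 1 else 0 := by
  obtain ⟨F₀, h₀⟩ := h.graph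
  refine (hO.ask_connected (h₀.congr State.view_call) (u := u) (v := v) (by norm_num)
    (by norm_num) (by norm_num) le_rfl zero_le_one ?_ ?_).conseq le_rfl ?_
  · simp [State.call, State.setReg]
  · simp [State.call, State.setReg]
  · rintro s' - ⟨hs', h', hans⟩
    exact ⟨⟨⟨_, h'⟩, h.tree.imp fun _ h => h.congr (hs'.view.trans State.view_call), h.isForest⟩,
      hans⟩

end Updates

/-! ### The edge list in memory -/

/-- The cells that hold a list of edges. -/
def cells {n : ℕ} (L : List (Fin n × Fin n)) (i : ℕ) : ℕ :=
  (L.flatMap fun e => [(e.1 : ℕ), (e.2 : ℕ)]).getD i 0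

section Cells

variable {n : ℕ}

theorem length_flatMap_pair (L : List (Fin n × Fin n)) :
    (L.flatMap fun e => [(e.1 : ℕ), (e.2 : ℕ)]).length = 2 * L.length := by
  induction L with
  | nil => rfl
  | cons e L ih => simp only [List.flatMap_cons, List.length_append, List.length_cons,
      List.length_nil, ih]; omega

theorem cells_eq_zero {L : List (Fin n × Fin n)} {i : ℕ} (h : 2 * L.length ≤ i) :
    cells L i = 0 :=
  List.getD_eq_default _ _ (by rwa [length_flatMap_pair])

theorem cells_cons_add_two (e : Fin n × Fin n) (L : List (Fin n × Fin n)) (i : ℕ) :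
    cells (e :: L) (i + 2) = cells L i := by
  simp [cells]

theorem cells_two_mul {L : List (Fin n × Fin n)} {j : ℕ} (h : j < L.length) :
    cells L (2 * j) = L[j].1 ∧ cells L (2 * j + 1) = L[j].2 := by
  induction L generalizing j with
  | nil => simp at h
  | cons e L ih =>
    cases j with
    | zero => simp [cells]
    | succ j =>
      have := ih (j := j) (by simpa using h)
      rw [show 2 * (j + 1) = 2 * j + 2 by ring, show 2 * j + 2 + 1 = (2 * j + 1) + 2 by ring,
        cells_cons_add_two, cells_cons_add_two]
      simpa using this

/-- Describes the two stores by which an edge is added to the input of the second copy. -/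
theorem cells_append (M : List (Fin n × Fin n)) (e : Fin n × Fin n) :
    cells (M ++ [e]) = Function.update (Function.update (cells M) (2 * M.length) e.1)
      (2 * M.length + 1) e.2 := by
  funext i
  have hl := length_flatMap_pair M
  simp only [cells, List.flatMap_append, List.flatMap_singleton, Function.update_apply]
  split_ifs with h₁ h₂
  · subst h₁
    rw [List.getD_append_right _ _ _ _ (by omega), hl]
    simp
  · subst h₂
    rw [List.getD_append_right _ _ _ _ (by omega), hl]
    simp
  · by_cases h : i < 2 * M.length
    · rw [List.getD_append _ _ _ _ (by omega)]
    · rw [List.getD_eq_default _ _ (by simp [hl]; omega), List.getD_eq_default _ _ (by omega)]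

theorem size_cells_le {S : ℕ} (hS : ∀ w : Fin n, (w : ℕ).size ≤ S) (L : List (Fin n × Fin n))
    (i : ℕ) : (cells L i).size ≤ S := by
  by_cases h : 2 * L.length ≤ i
  · simp [cells_eq_zero h]
  · rcases Nat.even_or_odd' i with ⟨j, rfl | rfl⟩
    · rw [(cells_two_mul (L := L) (j := j) (by omega)).1]
      exact hS _
    · rw [(cells_two_mul (L := L) (j := j) (by omega)).2]
      exact hS _

end Cells

/-- Memory in which only array 0 is used. -/
def State.ofArr (f : ℕ → ℕ) : State where
  reg _ := 0
  arr a := if a = 0 then f else fun _ => 0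

theorem State.ofArr_setArr (f : ℕ → ℕ) (i x : ℕ) :
    (State.ofArr f).setArr 0 i x = State.ofArr (Function.update f i x) := by
  simp only [State.ofArr, State.setArr, State.mk.injEq, true_and]
  funext a
  by_cases h : a = 0 <;> simp [h]

theorem inputState_eq {n : ℕ} (L : List (Fin n × Fin n)) :
    inputState n L = ((State.ofArr (cells L)).setReg 0 n).setReg 1 L.length := by
  simp only [inputState, State.ofArr, State.setReg, State.mk.injEq]
  constructor
  · funext r
    by_cases h : r = 0
    · simp [h]
    · by_cases h₁ : r = 1 <;> simp [h, h₁]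
  · funext a i
    by_cases h : a = 0 <;> simp [h, cells]

theorem State.view_setArr_of_ne {s : State} {i i' : Bool} (h : i' ≠ i) (a j x : ℕ) :
    (s.setArr (arrOf i a) j x).view i' = s.view i' := by
  simp only [State.view, State.comap, State.setArr, State.mk.injEq, true_and]
  funext k
  refine Function.update_of_ne ?_ _ _
  cases i <;> cases i' <;> simp [arrOf] at h ⊢ <;> omega

/-- The input uses only own registers and the own array 0, so both simulated memories start blank.
-/
theorem view_inputState {n : ℕ} (L : List (Fin n × Fin n)) (i : Bool) :
    (inputState n L).view i = State.ofArr fun _ => 0 := by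
  simp only [State.view, State.comap, State.ofArr, inputState, State.mk.injEq]
  constructor
  · funext r
    rw [if_neg (by simp only [regOf]; omega), if_neg (by simp only [regOf]; omega)]
  · funext a j
    rw [if_neg (by simp only [arrOf]; omega)]
    simp

/-! ### Copying the input -/

/-- Copies one cell of the input to array 1 and to the first simulated memory. -/
def copyStep : Prog :=
  .seq (.const 9 1) <| .seq (.arith .sub 2 2 9) <| .seq (.load 3 0 2) <|
    .seq (.store (arrOf false 0) 2 3) (.store 1 2 3)

/-- Copies the input to array 1 and to the first simulated memory. -/
def copyProg : Prog :=
  .seq (.seq (.mov 11 0) (.arith .add 2 1 1)) <| .seq (.loop 2 copyStep)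
    (.seq (.mov (regOf false 0) 11) (.mov (regOf false 1) 1))

/-- The function with its values below `k` replaced by zero. -/
def tailFrom (k : ℕ) (f : ℕ → ℕ) (i : ℕ) : ℕ := if k ≤ i then f i else 0

theorem update_tailFrom (k : ℕ) (f : ℕ → ℕ) :
    Function.update (tailFrom (k + 1) f) k (f k) = tailFrom k f := by
  funext i
  by_cases h : i = k
  · simp [h, tailFrom]
  · rw [Function.update_of_ne h]
    simp only [tailFrom]
    congr 1
    exact propext ⟨fun h' => by omega, fun h' => by omega⟩

section Init

variable {r : Regime} {A : DynAlg Set.univ} {n : ℕ} {forest : State → SimpleGraph (Fin n)}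
  {T S Z : ℕ} {s : State} {G F : SimpleGraph (Fin n)} {L : List (Fin n × Fin n)}

/-- All but the first `k` cells of the input have been copied. -/
structure Copying (L : List (Fin n × Fin n)) (k : ℕ) (s : State) : Prop where
  count : s.reg 2 = k
  bound : k ≤ 2 * L.length
  order : s.reg 11 = n
  length : s.reg 1 = L.length
  input : s.arr 0 = cells L
  copy : s.arr 1 = tailFrom k (cells L)
  view_false : s.view false = State.ofArr (tailFrom k (cells L))
  view_true : s.view true = State.ofArr fun _ => 0

theorem Triple.copyStep {k : ℕ} (hS : ∀ w : Fin n, (w : ℕ).size ≤ S)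
    (hZ : (3 * L.length + 2).size ≤ Z) (h : Copying L (k + 1) s) :
    Triple r copyStep s ((7 + 4 * Z + 3 * S : ℕ) : ℝ≥0∞) fun s' _ => Copying L k s' := by
  have hk : (k + 1).size ≤ Z := (Nat.size_le_size (by have := h.bound; omega)).trans hZ
  have hk' : k.size ≤ Z := (Nat.size_le_size (by omega)).trans hk
  have hc := size_cells_le hS L k
  refine (Triple.straight (p := DynForest.copyStep) ?_ ?_).conseq le_rfl ?_
  · simp [DynForest.copyStep, Prog.IsStraight]
  · simp [DynForest.copyStep, Prog.cost, Prog.exec, State.setReg, State.setArr, BinOp.eval,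
      h.count, h.input]
    omega
  · rintro s' - rfl
    refine ⟨?_, ?_, ?_, ?_, ?_, ?_, ?_, ?_⟩
    · simp [DynForest.copyStep, Prog.exec, State.setReg, State.setArr, BinOp.eval, h.count]
    · have := h.bound; omega
    · simp [DynForest.copyStep, Prog.exec, State.setReg, State.setArr, h.order]
    · simp [DynForest.copyStep, Prog.exec, State.setReg, State.setArr, h.length]
    · simp [DynForest.copyStep, Prog.exec, State.setReg, State.setArr, h.input, arrOf]
    · simp [DynForest.copyStep, Prog.exec, State.setReg, State.setArr, BinOp.eval, h.input,
        arrOf, h.count, h.copy, update_tailFrom]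
    · simp [DynForest.copyStep, Prog.exec, State.view_setReg_own, State.view_setArr_own,
        State.view_setArr, h.view_false, State.ofArr_setArr]
      simp [State.setReg, BinOp.eval, h.input, h.count, update_tailFrom]
    · simp [DynForest.copyStep, Prog.exec, State.view_setReg_own, State.view_setArr_own,
        State.view_setArr_of_ne, h.view_true]

/-- The input has been copied. -/
structure Copied (L : List (Fin n × Fin n)) (s : State) : Prop where
  order : s.reg 11 = n
  length : s.reg 1 = L.length
  copy : s.arr 1 = cells L
  view_true : s.view true = State.ofArr fun _ => 0

/-- The simulated memory has to equal the input state exactly, blank cells included, since the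
behaviour of the initialization is specified only there. Array 1 keeps another copy of the edges
because array 0 will be overwritten by the output. -/
theorem Triple.copyProg (hS : ∀ w : Fin n, (w : ℕ).size ≤ S) (hn : n.size ≤ S)
    (hZ : (3 * L.length + 2).size ≤ Z) :
    Triple r copyProg (inputState n L)
      ((20 + 2 * S + 4 * Z + 2 * L.length * (8 + 5 * Z + 3 * S) : ℕ) : ℝ≥0∞) fun s' _ =>
      Copied L s' ∧ s'.view false = inputState n L := by
  have hm : L.length.size ≤ Z := (Nat.size_le_size (by omega)).trans hZ
  refine Triple.seq (T₁ := 3 + S + 2 * Z)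
    (T₂ := 10 + S + 2 * Z + 2 * L.length * (8 + 5 * Z + 3 * S))
    (Triple.straight ?_ ?_) ?_ (by omega)
  · simp [Prog.mov, Prog.IsStraight]
  · simp [Prog.mov, Prog.cost, Prog.exec, State.setReg, inputState]
    omega
  rintro s₁ - hs₁
  have hstart : Copying L (2 * L.length) s₁ := by
    subst hs₁
    -- Beyond the `2 * L.length` cells of the list everything is zero, so before the first pass
    -- blank memory already agrees with the tail.
    have hzero : tailFrom (2 * L.length) (cells L) = fun _ => 0 := by
      funext i
      simp only [tailFrom]
      split_ifs with h
      · exact cells_eq_zero h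
      · rfl
    refine ⟨?_, le_rfl, ?_, ?_, ?_, ?_, ?_, ?_⟩
    · simp [Prog.exec, Prog.mov, State.setReg, BinOp.eval, inputState]
      omega
    · simp [Prog.exec, Prog.mov, State.setReg, BinOp.eval, inputState]
    · simp [Prog.exec, Prog.mov, State.setReg, inputState]
    · funext i
      simp [Prog.exec, Prog.mov, State.setReg, inputState, cells]
    · rw [hzero]
      funext i
      simp [Prog.exec, Prog.mov, State.setReg, inputState]
    · simp [Prog.exec, Prog.mov, State.view_setReg_own, view_inputState, hzero]
    · simp [Prog.exec, Prog.mov, State.view_setReg_own, view_inputState]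
  clear hs₁
  refine Triple.seq (T₁ := 2 * L.length * (8 + 5 * Z + 3 * S) + 1) (T₂ := 4 + S + Z)
    ((Triple.loop (T := 7 + 4 * Z + 3 * S) (T₀ := Z) (I := Copying L) ?_ ?_ hstart).conseq
      (le_of_eq (by ring)) fun _ _ => id) ?_ (by omega)
  · intro k s hs
    rw [hs.count]
    exact (Nat.size_le_size (by have := hs.bound; omega)).trans hZ
  · intro k s hs hne
    rw [hs.count] at hne
    obtain ⟨k', rfl⟩ := Nat.exists_eq_succ_of_ne_zero hne
    exact ⟨k', rfl, Triple.copyStep hS hZ hs⟩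
  · rintro s₂ - ⟨k, hs₂, h₀⟩
    obtain rfl : k = 0 := by rw [← hs₂.count, h₀]
    have htail : tailFrom 0 (cells L) = cells L := by
      funext i
      simp [tailFrom]
    refine (Triple.set_args (by norm_num) (by norm_num) ?_).conseq le_rfl ?_
    · rw [hs₂.order, hs₂.length]
      omega
    · rintro s₃ - ⟨hs₃, hv⟩
      refine ⟨⟨?_, ?_, ?_, ?_⟩, ?_⟩
      · rw [hs₃.reg _ (by norm_num), hs₂.order]
      · rw [hs₃.reg _ (by norm_num), hs₂.length]
      · rw [hs₃.arr _ (by norm_num), hs₂.copy, htail]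
      · exact hs₃.view.trans hs₂.view_true
      · rw [hv, hs₂.view_false, htail, hs₂.order, hs₂.length, inputState_eq]

/-! ### Collecting the edges of the forest -/

/-- Reads the end points of the next edge. -/
def readEdge : Prog :=
  .seq (.const 9 1) <| .seq (.arith .sub 2 2 9) <| .seq (.arith .add 4 2 2) <|
    .seq (.load 5 1 4) <| .seq (.arith .add 4 4 9) (.load 6 1 4)

/-- Appends the edge to the edge list in the second simulated memory. -/
def appendEdge : Prog :=
  .seq (.arith .add 4 0 0) <| .seq (.store (arrOf true 0) 4 5) <| .seq (.const 9 1) <|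
    .seq (.arith .add 4 4 9) (.store (arrOf true 0) 4 6)

/-- Handles one edge of the input. -/
def collectStep (A : DynAlg Set.univ) : Prog :=
  .seq readEdge <| .seq (.ask false (A.query ⟨.forestEdge, trivial⟩) 5 6 7 1 0) <|
    .branch 7 (.seq appendEdge (.emit .insert 5 6)) .skip

/-- Collects the edges of the forest, as output and as input for the second simulated memory. -/
def collectProg (A : DynAlg Set.univ) : Prog :=
  .seq (.seq (.const 0 0) (.mov 2 1)) <| .seq (.loop 2 (collectStep A))
    (.seq (.mov (regOf true 0) 11) (.mov (regOf true 1) 0))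

open Classical in
/-- The edges of the graph in a list, in reverse order. -/
noncomputable def edgesIn (F : SimpleGraph (Fin n)) (L : List (Fin n × Fin n)) :
    List (Fin n × Fin n) :=
  (L.filter fun e => F.Adj e.1 e.2).reverse

/-- The loop runs from the last input edge to the first. Thanks to the reversal, the edge that it
handles next goes to the end of the list, where the programs append it. -/
theorem edgesIn_cons_of_adj {e : Fin n × Fin n} (h : F.Adj e.1 e.2) :
    edgesIn F (e :: L) = edgesIn F L ++ [e] := by
  simp [edgesIn, h]

theorem edgesIn_cons_of_not_adj {e : Fin n × Fin n} (h : ¬ F.Adj e.1 e.2) :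
    edgesIn F (e :: L) = edgesIn F L := by
  simp [edgesIn, h]

theorem length_edgesIn_le : (edgesIn F L).length ≤ L.length := by
  rw [edgesIn, List.length_reverse]
  exact List.length_filter_le _ _

theorem Lists.edgesIn (h : Lists L G) (hF : F ≤ G) : Lists (edgesIn F L) F := by
  classical
  refine ⟨?_, fun e => ⟨fun he => ?_, fun he => ?_⟩⟩
  · rw [DynForest.edgesIn, List.map_reverse, List.nodup_reverse]
    exact h.1.sublist (List.filter_sublist.map _)
  · simp only [DynForest.edgesIn, List.mem_map, List.mem_reverse, List.mem_filter,
      decide_eq_true_eq] at he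
    obtain ⟨a, ⟨-, ha⟩, rfl⟩ := he
    exact ha
  · have := (h.2 e).2 (SimpleGraph.edgeSet_mono hF he)
    simp only [DynForest.edgesIn, List.mem_map, List.mem_reverse, List.mem_filter,
      decide_eq_true_eq] at this ⊢
    obtain ⟨a, ha, rfl⟩ := this
    exact ⟨a, ⟨ha, he⟩, rfl⟩

/-- The entries of the output for a list of insertions. -/
def insertions (M : List (Fin n × Fin n)) : List (UpdateKind × ℕ × ℕ) :=
  M.map fun e => (UpdateKind.insert, (e.1 : ℕ), (e.2 : ℕ))

/-- All edges but the first `k` have been handled. -/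
structure Collecting (A : DynAlg Set.univ) (forest : State → SimpleGraph (Fin n))
    (G F : SimpleGraph (Fin n)) (L : List (Fin n × Fin n)) (k : ℕ) (s : State) : Prop where
  count : s.reg 2 = k
  bound : k ≤ L.length
  order : s.reg 11 = n
  copy : s.arr 1 = cells L
  length : s.reg 0 = (edgesIn F (L.drop k)).length
  output : s.output = insertions (edgesIn F (L.drop k))
  holds : Holds A forest false s G F
  view_true : s.view true = State.ofArr (cells (edgesIn F (L.drop k)))

theorem Triple.readEdge {k : ℕ} (hS : ∀ w : Fin n, (w : ℕ).size ≤ S)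
    (hZ : (3 * L.length + 2).size ≤ Z) (hk : k < L.length) (h2 : s.reg 2 = k + 1)
    (h1 : s.arr 1 = cells L) :
    Triple r readEdge s ((9 + 6 * Z + 2 * S : ℕ) : ℝ≥0∞) fun s' _ =>
      s'.reg 2 = k ∧ s'.reg 5 = (L[k].1 : ℕ) ∧ s'.reg 6 = (L[k].2 : ℕ) ∧ s'.arr = s.arr ∧
      (∀ i, s'.view i = s.view i) ∧ s'.reg 0 = s.reg 0 ∧ s'.reg 11 = s.reg 11 := by
  have hsize : ∀ m, m ≤ 3 * L.length + 2 → m.size ≤ Z := fun m hm =>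
    (Nat.size_le_size hm).trans hZ
  have e1 := hsize (k + 1) (by omega)
  have e2 := hsize k (by omega)
  have e3 := hsize (k + k) (by omega)
  have e4 := hsize (k + k + 1) (by omega)
  have c1 := size_cells_le hS L (k + k)
  have c2 := size_cells_le hS L (k + k + 1)
  have hcells := cells_two_mul hk
  rw [two_mul] at hcells
  refine (Triple.straight (p := DynForest.readEdge) ?_ ?_).conseq le_rfl ?_
  · simp [DynForest.readEdge, Prog.IsStraight]
  · simp [DynForest.readEdge, Prog.cost, Prog.exec, State.setReg, BinOp.eval, h2, h1]
    omega
  · rintro s' - rfl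
    refine ⟨?_, ?_, ?_, ?_, ?_, ?_, ?_⟩
    · simp [DynForest.readEdge, Prog.exec, State.setReg, BinOp.eval, h2]
    · simp [DynForest.readEdge, Prog.exec, State.setReg, BinOp.eval, h2, h1, hcells]
    · simp [DynForest.readEdge, Prog.exec, State.setReg, BinOp.eval, h2, h1, hcells]
    · simp [DynForest.readEdge, Prog.exec, State.setReg]
    · intro i
      simp [DynForest.readEdge, Prog.exec, State.view_setReg_own]
    · simp [DynForest.readEdge, Prog.exec, State.setReg]
    · simp [DynForest.readEdge, Prog.exec, State.setReg]

theorem Triple.appendEdge {M : List (Fin n × Fin n)} {e : Fin n × Fin n}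
    (hS : ∀ w : Fin n, (w : ℕ).size ≤ S)
    (hZ : (3 * M.length + 2).size ≤ Z) (h0 : s.reg 0 = M.length) (h5 : s.reg 5 = (e.1 : ℕ))
    (h6 : s.reg 6 = (e.2 : ℕ)) (hv : s.view true = State.ofArr (cells M)) :
    Triple r appendEdge s ((7 + 5 * Z + 2 * S : ℕ) : ℝ≥0∞) fun s' _ =>
      (∀ x, x ≠ 4 → x ≠ 9 → s'.reg x = s.reg x) ∧ (∀ a < 2, s'.arr a = s.arr a) ∧
      s'.view false = s.view false ∧ s'.view true = State.ofArr (cells (M ++ [e])) := by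
  have hsize : ∀ m, m ≤ 3 * M.length + 2 → m.size ≤ Z := fun m hm =>
    (Nat.size_le_size hm).trans hZ
  have e2 := hsize M.length (by omega)
  have e3 := hsize (M.length + M.length) (by omega)
  have e4 := hsize (M.length + M.length + 1) (by omega)
  have c1 := hS e.1
  have c2 := hS e.2
  refine (Triple.straight (p := DynForest.appendEdge) ?_ ?_).conseq le_rfl ?_
  · simp [DynForest.appendEdge, Prog.IsStraight]
  · simp [DynForest.appendEdge, Prog.cost, Prog.exec, State.setReg, State.setArr, BinOp.eval,
      h0, h5, h6]
    omega
  · rintro s' - rfl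
    refine ⟨?_, ?_, ?_, ?_⟩
    · intro x hx4 hx9
      simp [DynForest.appendEdge, Prog.exec, State.setReg, State.setArr,
        Function.update_of_ne hx4, Function.update_of_ne hx9]
    · intro a ha
      have ha' : a ≠ arrOf true 0 := by simp only [arrOf]; omega
      simp [DynForest.appendEdge, Prog.exec, State.setReg, State.setArr,
        Function.update_of_ne ha']
    · simp [DynForest.appendEdge, Prog.exec, State.view_setReg_own, State.view_setArr_of_ne]
    · simp [DynForest.appendEdge, Prog.exec, State.view_setReg_own, State.view_setArr,
        hv, State.ofArr_setArr]
      simp [State.setReg, State.setArr, BinOp.eval, h0, h5, h6, cells_append, two_mul]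

theorem Oracle.collectStep (hO : Oracle r A n forest T S) {k : ℕ}
    (hZ : (3 * L.length + 2).size ≤ Z) (h : Collecting A forest G F L (k + 1) s) :
    Triple r (collectStep A) s ((55 + 18 * Z + 11 * S + 2 * T : ℕ) : ℝ≥0∞) fun s' _ =>
      Collecting A forest G F L k s' := by
  classical
  have hk : k < L.length := h.bound
  have hdrop : L.drop k = L[k] :: L.drop (k + 1) := List.drop_eq_getElem_cons hk
  have hlen : (edgesIn F (L.drop (k + 1))).length ≤ L.length :=
    length_edgesIn_le.trans (by simp)
  have hZ' : (3 * (edgesIn F (L.drop (k + 1))).length + 2).size ≤ Z :=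
    (Nat.size_le_size (by omega)).trans hZ
  have c1 := hO.size_le L[k].1
  have c2 := hO.size_le L[k].2
  refine Triple.seq (T₂ := 46 + 12 * Z + 9 * S + 2 * T)
    (Triple.readEdge hO.size_le hZ hk h.count h.copy) ?_ (by omega)
  rintro s₁ - ⟨h2, h5, h6, harr, hview, h0, h11⟩
  refine Triple.seq (T₂ := 34 + 12 * Z + 4 * S)
    (hO.ask_forestEdge (h.holds.congr (hview _)) (by norm_num) (by norm_num) (by norm_num)
      le_rfl zero_le_one h5 h6) ?_ (by omega)
  rintro s₂ - ⟨hs₂, hG₂, h7⟩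
  have k2 := (hs₂.reg 2 (by norm_num) (by norm_num)).trans h2
  have k5 := (hs₂.reg 5 (by norm_num) (by norm_num)).trans h5
  have k6 := (hs₂.reg 6 (by norm_num) (by norm_num)).trans h6
  have k0 := ((hs₂.reg 0 (by norm_num) (by norm_num)).trans h0).trans h.length
  have k11 := ((hs₂.reg 11 (by norm_num) (by norm_num)).trans h11).trans h.order
  have karr : ∀ a < 2, s₂.arr a = s.arr a := fun a ha => (hs₂.arr a ha).trans (by rw [harr])
  have kview : s₂.view true = State.ofArr (cells (edgesIn F (L.drop (k + 1)))) :=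
    (hs₂.view.trans (hview _)).trans h.view_true
  have kout : s₂.output = insertions (edgesIn F (L.drop (k + 1))) :=
    (State.output_congr (k0.trans h.length.symm) (karr 0 (by norm_num))).trans h.output
  have kcopy := (karr 1 (by norm_num)).trans h.copy
  refine Triple.branch (T₀ := 32 + 12 * Z + 4 * S) (fun hne => ?_) (fun he => ?_) ?_
  · have hadj : F.Adj L[k].1 L[k].2 := by
      by_contra hn
      rw [h7, if_neg hn] at hne
      exact hne rfl
    refine Triple.seq (T₂ := 25 + 7 * Z + 2 * S)
      (Triple.appendEdge hO.size_le hZ' k0 k5 k6 kview) ?_ (by omega)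
    rintro s₃ - ⟨mreg, marr, mfalse, mtrue⟩
    have m0 := (mreg 0 (by norm_num) (by norm_num)).trans k0
    have m5 := (mreg 5 (by norm_num) (by norm_num)).trans k5
    have m6 := (mreg 6 (by norm_num) (by norm_num)).trans k6
    refine (Triple.emit (Z := Z) (T := 25 + 7 * Z + 2 * S) (by norm_num) (by norm_num)
      ?_ ?_).conseq le_rfl ?_
    · rwa [m0]
    · rw [m5, m6]; omega
    · rintro s₄ - hs₄
      rw [← edgesIn_cons_of_adj hadj, ← hdrop] at mtrue
      refine ⟨?_, hk.le, ?_, ?_, ?_, ?_, hG₂.congr ((hs₄.view _).trans mfalse),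
        (hs₄.view _).trans mtrue⟩
      · rw [hs₄.reg _ (by norm_num) (by norm_num) (by norm_num) (by norm_num),
          mreg _ (by norm_num) (by norm_num), k2]
      · rw [hs₄.reg _ (by norm_num) (by norm_num) (by norm_num) (by norm_num),
          mreg _ (by norm_num) (by norm_num), k11]
      · rw [hs₄.arr _ (by norm_num), marr _ (by norm_num), kcopy]
      · rw [hs₄.count, m0, hdrop, edgesIn_cons_of_adj hadj, List.length_append,
          List.length_singleton]
      · rw [hs₄.output, State.output_congr (m0.trans k0.symm) (marr 0 (by norm_num)), kout, m5,
          m6, hdrop, edgesIn_cons_of_adj hadj]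
        simp [insertions]
  · have hadj : ¬ F.Adj L[k].1 L[k].2 := by
      intro hr
      rw [h7, if_pos hr] at he
      exact one_ne_zero he
    refine (Triple.straight (p := .skip) trivial (T := 1) le_rfl).conseq (by omega) ?_
    rintro s₃ - rfl
    rw [← edgesIn_cons_of_not_adj hadj, ← hdrop] at k0 kview kout
    exact ⟨k2, hk.le, k11, kcopy, k0, kout, hG₂, kview⟩
  · rw [h7]
    split_ifs <;> simp <;> omega

/-- The output counter in register 0 is also the number of edges collected, so it is passed to the
second copy as its edge count. -/
theorem Oracle.collectProg (hO : Oracle r A n forest T S) (hn : n.size ≤ S)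
    (hZ : (3 * L.length + 2).size ≤ Z) (h : Copied L s) (hG : Holds A forest false s G F) :
    Triple r (collectProg A) s
      ((20 + S + 3 * Z + L.length * (56 + 19 * Z + 11 * S + 2 * T) : ℕ) : ℝ≥0∞) fun s' _ =>
      s'.view true = inputState n (edgesIn F L) ∧ s'.output = insertions (edgesIn F L) ∧
        Holds A forest false s' G F := by
  have hm : L.length.size ≤ Z := (Nat.size_le_size (by omega)).trans hZ
  have hm' : (edgesIn F L).length.size ≤ Z := (Nat.size_le_size length_edgesIn_le).trans hm
  refine Triple.seq (T₁ := 3 + Z)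
    (T₂ := 10 + S + 2 * Z + L.length * (56 + 19 * Z + 11 * S + 2 * T))
    (Triple.straight ?_ ?_) ?_ (by omega)
  · simp [Prog.mov, Prog.IsStraight]
  · simp [Prog.mov, Prog.cost, Prog.exec, State.setReg, h.length]
    omega
  rintro s₁ - hs₁
  have hstart : Collecting A forest G F L L.length s₁ := by
    subst hs₁
    refine ⟨?_, le_rfl, ?_, ?_, ?_, ?_, hG.congr ?_, ?_⟩
    · simp [Prog.exec, Prog.mov, State.setReg, BinOp.eval, h.length]
    · simp [Prog.exec, Prog.mov, State.setReg, h.order]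
    · simp [Prog.exec, Prog.mov, State.setReg, h.copy]
    · simp [Prog.exec, Prog.mov, State.setReg, edgesIn]
    · rw [State.output_eq_nil (by simp [Prog.exec, Prog.mov, State.setReg])]
      simp [edgesIn, insertions]
    · simp [Prog.exec, Prog.mov, State.view_setReg_own]
    · simp only [Prog.exec, Prog.mov, State.view_setReg_own, h.view_true, Nat.ofNat_pos,
        Nat.reduceLT]
      simp [edgesIn]
      rfl
  clear hs₁
  refine Triple.seq (T₁ := L.length * (56 + 19 * Z + 11 * S + 2 * T) + 1) (T₂ := 4 + S + Z)
    ((Triple.loop (T := 55 + 18 * Z + 11 * S + 2 * T) (T₀ := Z)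
      (I := Collecting A forest G F L) ?_ ?_ hstart).conseq
      (le_of_eq (by ring)) fun _ _ => id) ?_ (by omega)
  · intro k s hs
    rw [hs.count]
    exact (Nat.size_le_size hs.bound).trans hm
  · intro k s hs hne
    rw [hs.count] at hne
    obtain ⟨k', rfl⟩ := Nat.exists_eq_succ_of_ne_zero hne
    exact ⟨k', rfl, hO.collectStep hZ hs⟩
  · rintro s₂ - ⟨k, hs₂, h₀⟩
    obtain rfl : k = 0 := by rw [← hs₂.count, h₀]
    have hlen := hs₂.length
    have hout := hs₂.output
    have hv := hs₂.view_true
    rw [List.drop_zero] at hlen hout hv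
    refine (Triple.set_args (by norm_num) (by norm_num) ?_).conseq le_rfl ?_
    · rw [hs₂.order, hlen]
      omega
    · rintro s₃ - ⟨hs₃, hv₃⟩
      refine ⟨?_, ?_, hs₂.holds.congr hs₃.view⟩
      · rw [hv₃, hv, hs₂.order, hlen, inputState_eq]
      · rw [State.output_congr (hs₃.reg 0 (by norm_num)) (hs₃.arr 0 (by norm_num)), hout]

/-! ### The initialization -/

/-- The initialization: the forest that the algorithm represents becomes the explicit forest. -/
def initProg (A : DynAlg Set.univ) : Prog :=
  .seq copyProg <| .seq (A.init.rename (regOf false) (arrOf false)) <| .seq (collectProg A)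
    (A.init.rename (regOf true) (arrOf true))

/-- With `T₀ = ⊤` this gives mere halting, with a finite `T₀` the time bound. The bound `T₀` is
asked for all lists no longer than `L` because the second initialization runs on a forest with at
most as many edges. -/
theorem Oracle.init (hO : Oracle r A n forest T S) (hn : n.size ≤ S) (hL : Lists L G)
    (hZ : (3 * L.length + 2).size ≤ Z) {T₀ : ℝ≥0∞}
    (hinit : ∀ (L' : List (Fin n × Fin n)) (G' : SimpleGraph (Fin n)), Lists L' G' →
      L'.length ≤ L.length → HaltsBy r A.init (inputState n L') T₀) :
    Triple r (initProg A) (inputState n L)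
      (((20 + 2 * S + 4 * Z + 2 * L.length * (8 + 5 * Z + 3 * S) : ℕ) : ℝ≥0∞) + (T₀ +
        (((20 + S + 3 * Z + L.length * (56 + 19 * Z + 11 * S + 2 * T) : ℕ) : ℝ≥0∞) + T₀)))
      fun s' _ => ∃ F, Changes s'.output ⊥ F ∧ Inv A forest s' G F := by
  refine (Triple.seq_add (Triple.copyProg hO.size_le hn hZ)
    (Q₂ := fun s' _ => ∃ F, Changes s'.output ⊥ F ∧ Inv A forest s' G F) ?_).mono le_rfl
    fun _ _ h => h.choose_spec
  rintro s₁ - ⟨hs₁, hv₁⟩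
  refine (Triple.seq_add (Triple.rename (regOf_injective false) (arrOf_injective false)
    (s := s₁) (T := T₀) ?_)
    (Q₂ := fun s' _ => ∃ F, Changes s'.output ⊥ F ∧ Inv A forest s' G F) ?_).mono le_rfl
    fun _ _ h => h.choose_spec
  · change HaltsBy r A.init (s₁.view false) T₀
    rw [hv₁]
    exact hinit L G hL le_rfl
  rintro s₂ t ⟨⟨b, hr⟩, ha⟩
  change Run A.init (s₁.view false) b (s₂.view false) t at hr
  rw [hv₁] at hr
  have hs₂ := State.SameOff.of_agreeOff ha
  have hcopied : Copied L s₂ :=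
    ⟨(hs₂.reg _ (by norm_num)).trans hs₁.order, (hs₂.reg _ (by norm_num)).trans hs₁.length,
      (hs₂.arr _ (by norm_num)).trans hs₁.copy, hs₂.view.trans hs₁.view_true⟩
  -- Whatever forest the first copy happens to represent becomes the explicit one; the queries that
  -- collect its edges leave it unchanged.
  have hG : Holds A forest false s₂ G (forest (s₂.view false)) := ⟨.init hL hr, rfl⟩
  generalize forest (s₂.view false) = F at hG
  have hF := hO.isForest_of_holds hG
  have hLF := hL.edgesIn hF.2.1
  refine (Triple.seq_add (hO.collectProg hn hZ hcopied hG)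
    (Q₂ := fun s' _ => ∃ F, Changes s'.output ⊥ F ∧ Inv A forest s' G F) ?_).mono le_rfl
    fun _ _ h => h.choose_spec
  rintro s₃ - ⟨hv₃, hout, hG₃⟩
  refine (Triple.rename (regOf_injective true) (arrOf_injective true)
    (s := s₃) (T := T₀) ?_).mono le_rfl ?_
  · change HaltsBy r A.init (s₃.view true) T₀
    rw [hv₃]
    exact hinit _ F hLF length_edgesIn_le
  · rintro s₄ t ⟨⟨b, hr⟩, ha⟩
    change Run A.init (s₃.view true) b (s₄.view true) t at hr
    rw [hv₃] at hr
    have hs₄ := State.SameOff.of_agreeOff ha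
    refine ⟨F, ?_, ⟨F, hG₃.congr hs₄.view⟩, ⟨_, ⟨.init hLF hr, rfl⟩⟩, hF⟩
    rw [State.output_congr (hs₄.reg 0 (by norm_num)) (hs₄.arr 0 (by norm_num)), hout]
    exact Changes.insertions _ hLF.1 (fun e => by rw [hLF.2]; simp) (by simp)

end Init

/-! ### The algorithm -/

/-- Maintains an explicit maximal spanning forest by means of two copies of `A`, one for the graph
and one for the forest. -/
def explicitAlg (A : DynAlg Set.univ) : DynAlg {Query.connected} where
  init := initProg A
  update
    | .insert => insertProg A
    | .delete => deleteProg A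
  query _ := .ask false (A.query ⟨.connected, trivial⟩) 0 1 0 1 0

theorem DynAlg.IsDeterministic.explicitAlg {A : DynAlg Set.univ} (h : A.IsDeterministic) :
    (explicitAlg A).IsDeterministic := by
  obtain ⟨h₁, h₂, h₃⟩ := h
  refine ⟨?_, ?_, ?_⟩
  · simp [DynForest.explicitAlg, initProg, copyProg, copyStep, collectProg, collectStep, readEdge,
      appendEdge, Prog.emit, Prog.ask, Prog.callOn, Prog.mov, Prog.IsDeterministic, h₁.rename,
      (h₃ _).rename]
  · rintro (_ | _) <;>
    simp [DynForest.explicitAlg, insertProg, deleteProg, replaceProg, searchStep, Prog.setup,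
      Prog.emit, Prog.ask, Prog.callOn, Prog.mov, Prog.IsDeterministic, (h₂ _).rename,
      (h₃ _).rename]
  · intro q
    simp [DynForest.explicitAlg, Prog.ask, Prog.callOn, Prog.mov, Prog.IsDeterministic,
      (h₃ _).rename]

/-! ### The invariant in all reachable situations -/

section Correctness

variable {r : Regime} {A : DynAlg Set.univ} {n : ℕ} {forest : State → SimpleGraph (Fin n)}
  {T S : ℕ} {s : State} {G F : SimpleGraph (Fin n)} {u v : Fin n}

theorem Oracle.update_explicit (hO : Oracle r A n forest T S) (h : Inv A forest s G F)
    {k : UpdateKind} (hk : k.Legal G u v) :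
    Triple r ((explicitAlg A).update k) (s.call u v)
      ((250 + 9 * T + 29 * S + S * (42 + 5 * T + 14 * S) : ℕ) : ℝ≥0∞) fun s' _ =>
      Updated A forest F (k.apply G u v) s' := by
  cases k with
  | insert => exact (hO.insert h hk).conseq (by omega) fun _ _ => id
  | delete => exact hO.delete h hk

theorem Oracle.init_run (hO : Oracle r A n forest T S) (hn : n.size ≤ S)
    (hinit : A.InitHalts r) {L : List (Fin n × Fin n)} (hL : Lists L G) :
    Triple r (explicitAlg A).init (inputState n L) ⊤
      fun s' _ => ∃ F, Changes s'.output ⊥ F ∧ Inv A forest s' G F :=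
  (hO.init hn hL le_rfl fun L' G' hL' _ => haltsBy_top.2 (hinit n G' L' hL')).mono le_top
    fun _ _ => id

/-- `Reach` does not record the output, so the forest is only known to exist, which is all that the
time bounds need. -/
theorem Oracle.inv_of_reach (hO : Oracle r A n forest T S) (hn : n.size ≤ S)
    (hinit : A.InitHalts r) (h : (explicitAlg A).Reach n s G) : ∃ F, Inv A forest s G F := by
  induction h with
  | init hL hr =>
    obtain ⟨F, -, hF⟩ := (hO.init_run hn hinit hL).2 _ _ _ hr
    exact ⟨F, hF⟩
  | update _ hk hr ih =>
    obtain ⟨F, hF⟩ := ih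
    obtain ⟨-, F', -, hF'⟩ := (hO.update_explicit hF hk).2 _ _ _ hr
    exact ⟨F', hF'⟩
  | query _ hq hr ih =>
    obtain ⟨F, hF⟩ := ih
    exact ⟨F, ((hO.query hF _ _).2 _ _ _ hr).1⟩

/-- Lists of changes have a unique result, so the invariant holds for the very forest obtained from
the recorded output. -/
theorem Oracle.inv_of_reachOut (hO : Oracle r A n forest T S) (hn : n.size ≤ S)
    (hinit : A.InitHalts r) (h : (explicitAlg A).ReachOut n s G F) : Inv A forest s G F := by
  induction h with
  | init hL hr hF =>
    obtain ⟨F', h₁, h₂⟩ := (hO.init_run hn hinit hL).2 _ _ _ hr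
    rwa [hF.unique h₁]
  | update _ hk hr hF ih =>
    obtain ⟨-, F', h₁, h₂⟩ := (hO.update_explicit ih hk).2 _ _ _ hr
    rwa [hF.unique h₁]
  | query _ hq hr ih => exact ((hO.query ih _ _).2 _ _ _ hr).1

end Correctness

theorem explicitlyMaintainsForest_explicitAlg {r : Regime} {A : DynAlg Set.univ}
    (hinit : A.InitHalts r) (hO : ∀ n, n.size ≤ Nat.log 2 n + 1 ∧ ∃ forest T,
      Oracle r A n forest T (Nat.log 2 n + 1)) :
    (explicitAlg A).ExplicitlyMaintainsForest := by
  intro n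
  obtain ⟨hn, forest, T, hO⟩ := hO n
  refine ⟨fun L G hL b s t hr => ?_, fun s G F h => ?_⟩
  · obtain ⟨F, hF, -⟩ := (hO.init_run hn hinit hL).2 _ _ _ hr
    exact ⟨F, hF⟩
  · have hI := hO.inv_of_reachOut hn hinit h
    refine ⟨hI.isForest, fun k u v hk b s' t hr => ?_, ?_⟩
    · obtain ⟨h₀, F', hF', -⟩ := (hO.update_explicit hI hk).2 _ _ _ hr
      exact ⟨s'.length_output.trans_le h₀, F', hF'⟩
    · rintro ⟨q, rfl⟩ u v - b s' t hr
      obtain ⟨-, hans⟩ := (hO.query hI u v).2 _ _ _ hr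
      simp [Query.Answer, hans]

/-! ### Polylogarithmic and near-linear time bounds -/

theorem exists_oracle {r : Regime} {A : DynAlg Set.univ} (hforest : A.ProvidesForestAccess)
    (htime : A.PolylogTime r) :
    ∃ C k : ℕ, ∀ n, n.size ≤ Nat.log 2 n + 1 ∧ ∃ forest,
      Oracle r A n forest (C * (Nat.log 2 n + 1) ^ k) (Nat.log 2 n + 1) := by
  obtain ⟨forest, hf⟩ := hforest
  obtain ⟨C, k, ht⟩ := htime
  refine ⟨C, k, fun n => ?_⟩
  -- Hence `S = Nat.log 2 n + 1` bounds both the bit length of a vertex and the number of search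
  -- rounds; this includes `n = 0`.
  have hlt : n < 2 ^ (Nat.log 2 n + 1) := Nat.lt_pow_succ_log_self one_lt_two n
  exact ⟨Nat.size_le.2 hlt, forest n,
    { isForest := fun s G h => (hf n s G h).1
      answer := fun s G h q u v hq b s' t hr => (hf n s G h).2 ⟨q, trivial⟩ u v hq b s' t hr
      update_time := fun s G h k u v hk => (ht n s G h u v).1 k hk
      query_time := fun s G h q u v hq => (ht n s G h u v).2 ⟨q, trivial⟩ hq
      size_le := fun w => Nat.size_le.2 (w.2.trans hlt)
      le_two_pow := hlt.le }⟩

theorem polylogTime_explicitAlg {r : Regime} {A : DynAlg Set.univ}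
    (hforest : A.ProvidesForestAccess) (hinit : A.InitHalts r) (htime : A.PolylogTime r) :
    (explicitAlg A).PolylogTime r := by
  obtain ⟨C, k, hO⟩ := exists_oracle hforest htime
  -- In the bound for deletions, `335 = 250 + 29 + 42 + 14` and `14 = 9 + 5` collect the
  -- coefficients. The highest powers of `S` are `S * S` and `S * S ^ k`, both covered by the
  -- exponent `k + 2`.
  refine ⟨335 + 14 * C, k + 2, fun n s G h u v => ?_⟩
  obtain ⟨hn, forest, hO⟩ := hO n
  obtain ⟨F, hF⟩ := hO.inv_of_reach hn hinit h
  have hS : 1 ≤ Nat.log 2 n + 1 := by omega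
  generalize Nat.log 2 n + 1 = S at hO hS
  have h₀ : 1 ≤ S ^ (k + 2) := Nat.one_le_pow _ _ hS
  have h₁ : S ≤ S ^ (k + 2) := Nat.le_self_pow (by omega) S
  have h₂ : S * S ≤ S ^ (k + 2) := by
    rw [← sq]
    exact Nat.pow_le_pow_right hS (by omega)
  have h₃ : C * S ^ k ≤ C * S ^ (k + 2) :=
    Nat.mul_le_mul_left _ (Nat.pow_le_pow_right hS (by omega))
  have h₄ : S * (C * S ^ k) ≤ C * S ^ (k + 2) := by
    calc S * (C * S ^ k) = C * S ^ (k + 1) := by ring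
      _ ≤ C * S ^ (k + 2) := Nat.mul_le_mul_left _ (Nat.pow_le_pow_right hS (by omega))
  have hbound : 250 + 9 * (C * S ^ k) + 29 * S + S * (42 + 5 * (C * S ^ k) + 14 * S) ≤
      (335 + 14 * C) * S ^ (k + 2) := by
    nlinarith
  refine ⟨fun κ hκ => ?_, ?_⟩
  · exact haltsBy_natCast.1 ((hO.update_explicit hF hκ).1.mono (by exact_mod_cast hbound))
  · rintro ⟨q, rfl⟩ -
    exact haltsBy_natCast.1 ((hO.query hF u v).1.mono
      (by exact_mod_cast (by omega : _ ≤ _).trans hbound))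

theorem initNearLinear_explicitAlg {r : Regime} {A : DynAlg Set.univ}
    (hforest : A.ProvidesForestAccess) (htime : A.PolylogTime r) (hinit : A.InitNearLinear r) :
    (explicitAlg A).InitNearLinear r := by
  obtain ⟨C, k, hO⟩ := exists_oracle hforest htime
  obtain ⟨C₁, k₁, hinit⟩ := hinit
  -- Here `276 = 71 + 205`, from the parts of the bound that are constant and linear in the number
  -- of edges. The exponent dominates `1`, `k` and `k₁` simultaneously.
  refine ⟨276 + 2 * C + 2 * C₁, k + k₁ + 1, fun n G L hL => ?_⟩
  obtain ⟨hn, forest, hO⟩ := hO n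
  have hinit := hinit n
  have hS : 1 ≤ Nat.log 2 n + 1 := by omega
  generalize Nat.log 2 n + 1 = S at hO hS hn hinit ⊢
  -- There are at most `n * n < 4 ^ S` edges and `2 < 4 ^ S`, so every address is below `4 * 4 ^ S =
  -- 2 ^ (2 * S + 2)`.
  have hZ : (3 * L.length + 2).size ≤ 2 * S + 2 := by
    rw [Nat.size_le] at hn ⊢
    have h₁ := hL.length_le
    have h₂ : n * n ≤ 2 ^ S * 2 ^ S := Nat.mul_le_mul hn.le hn.le
    have h₃ : 2 ≤ 2 ^ S := Nat.le_self_pow (by omega) 2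
    have h₄ : 2 * 2 ≤ 2 ^ S * 2 ^ S := Nat.mul_le_mul h₃ h₃
    have h₅ : 2 ^ (2 * S + 2) = 4 * (2 ^ S * 2 ^ S) := by ring
    omega
  have h := hO.init hn hL hZ (T₀ := ((C₁ * (n + L.length + 1) * S ^ k₁ : ℕ) : ℝ≥0∞))
    fun L' G' hL' hle => (haltsBy_natCast.2 (hinit G' L' hL')).mono (by gcongr)
  refine haltsBy_natCast.1 (h.1.mono ?_)
  generalize L.length = m
  have h₀ : 1 ≤ S ^ (k + k₁ + 1) := Nat.one_le_pow _ _ hS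
  have h₁ : S ≤ S ^ (k + k₁ + 1) := Nat.le_self_pow (by omega) S
  have h₂ : S ^ k ≤ S ^ (k + k₁ + 1) := Nat.pow_le_pow_right hS (by omega)
  have h₃ : S ^ k₁ ≤ S ^ (k + k₁ + 1) := Nat.pow_le_pow_right hS (by omega)
  generalize S ^ (k + k₁ + 1) = E at *
  have hbound : 20 + 2 * S + 4 * (2 * S + 2) + 2 * m * (8 + 5 * (2 * S + 2) + 3 * S) +
      (C₁ * (n + m + 1) * S ^ k₁ + (20 + S + 3 * (2 * S + 2) +
        m * (56 + 19 * (2 * S + 2) + 11 * S + 2 * (C * S ^ k)) +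
        C₁ * (n + m + 1) * S ^ k₁)) ≤ (276 + 2 * C + 2 * C₁) * (n + m + 1) * E := by
    calc _ = 54 + 17 * S + m * (130 + 75 * S + 2 * (C * S ^ k)) +
          2 * (C₁ * (n + m + 1) * S ^ k₁) := by ring
      _ ≤ 54 * E + 17 * E + m * (130 * E + 75 * E + 2 * (C * E)) +
          2 * (C₁ * (n + m + 1) * E) := by gcongr <;> omega
      -- The added terms are exactly those missing from the expanded product with `n + m + 1`.
      _ ≤ 54 * E + 17 * E + m * (130 * E + 75 * E + 2 * (C * E)) +
          2 * (C₁ * (n + m + 1) * E) +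
          ((205 + 2 * C) * E + 71 * (m * E) + (276 + 2 * C) * (n * E)) := Nat.le_add_right _ _
      _ = _ := by ring
  exact_mod_cast hbound

end DynForest

theorem lemma3p9 (r : DynForest.Regime) (A : DynForest.DynAlg Set.univ)
    (hA_forest : A.ProvidesForestAccess) (hA_init : A.InitHalts r) (hA_time : A.PolylogTime r) :
    ∃ B : DynForest.DynAlg {DynForest.Query.connected},
      B.ExplicitlyMaintainsForest ∧ B.InitHalts r ∧ B.PolylogTime r ∧
        (A.InitNearLinear r → B.InitNearLinear r) ∧
        (A.IsDeterministic → B.IsDeterministic) := by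
  obtain ⟨C, k, hO⟩ := DynForest.exists_oracle hA_forest hA_time
  refine ⟨DynForest.explicitAlg A, ?_, fun n G L hL => ?_,
    DynForest.polylogTime_explicitAlg hA_forest hA_init hA_time,
    DynForest.initNearLinear_explicitAlg hA_forest hA_time, fun h => h.explicitAlg⟩
  · exact DynForest.explicitlyMaintainsForest_explicitAlg hA_init fun n =>
      ⟨(hO n).1, (hO n).2.imp fun _ h => ⟨_, h⟩⟩
  · obtain ⟨hn, forest, h⟩ := hO n
    exact (h.init_run hn hA_init hL).1.halts
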